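/- Let $\Omega=(-1,1)$, $T>0$, $Q=(0,T)\times\Omega$, let $\omega\subseteq\Omega$ be nonempty and measurable, $\omega_T=(0,T)\times\omega$. Let $a\in C^1([-1,1])$ satisfy $a>0$ on $(-1,1)$, $a(\pm1)=0$ and $x\mapsto\int_0^x\frac{ds}{a(s)}\in L^1(-1,1)$. Let $H^1_a(\Omega)$ be the space of locally absolutely continuous $u\in L^2(\Omega)$ with $\sqrt a\,u_x\in L^2(\Omega)$, with norm $\|u\|_{H^1_a}^2=\|u\|_{L^2}^2+\|\sqrt a\,u_x\|_{L^2}^2$, let $(H^1_a(\Omega))'$ be its dual with the dual norm, and put $$W_a(0,T)=\{\rho\in L^2(0,T;H^1_a(\Omega)):\ \rho_t\in L^2(0,T;(H^1_a(\Omega))')\},$$ $$H(Q)=\{\phi\in L^2(0,T;H^1_a(\Omega)):\ \phi_t\in L^2(Q),\ \phi(T,\cdot)=0\},$$ where time derivatives are distributional and values of $\phi$ at $t=0,T$ are those of its representative in $C([0,T];L^2(\Omega))$. Write $\|v\|_\infty$ for the norm of $L^\infty(\omega_T)$. Let $f\in L^2(0,T;(H^1_a(\Omega))')$, $v\in L^\infty(\omega_T)$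 and $p^0\in L^2(\Omega)$. (1) There is a unique weak solution $p\in W_a(0,T)$ of $$p_t-(a p_x)_x=v\chi_\omega p+f\ \text{in }Q,\qquad a p_x|_{x=\pm1}=0,\qquad p(0,\cdot)=p^0,$$ i.e. a unique $p\in W_a(0,T)$ such that for all $\phi\in H(Q)$ $$-\int_Q\phi_t p\,dx\,dt+\int_Q a\,p_x\phi_x\,dx\,dt-\int_{\omega_T}v p\phi\,dx\,dt=\int_\Omega p^0\phi(0,\cdot)\,dx+\int_0^T\langle f,\phi\rangle\,dt.$$ It has a representative in $C([0,T];L^2(\Omega))$ and $$\|p\|_{C([0,T];L^2(\Omega))}+\|p\|_{L^2(0,T;H^1_a(\Omega))}\le 2e^{(\|v\|_\infty+1)T}\big(\|p^0\|_{L^2(\Omega)}+\|f\|_{L^2(0,T;(H^1_a(\Omega))')}\big).$$ (2) For every $r>0$ there is a unique weak solution $z\in W_a(0,T)$ of $$z_t-(a z_x)_x+rz=v\chi_\omega z+e^{-rt}f\ \text{in }Q,\qquad a z_x|_{x=\pm1}=0,\qquad z(0,\cdot)=p^0,$$ i.e. a unique $z\in W_a(0,T)$ such that for all $\phi\in H(Q)$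 $$-\int_Q\phi_t z\,dx\,dt+\int_Q a\,z_x\phi_x\,dx\,dt+r\int_Q z\phi\,dx\,dt-\int_{\omega_T}v z\phi\,dx\,dt=\int_\Omega p^0\phi(0,\cdot)\,dx+\int_0^T e^{-rt}\langle f,\phi\rangle\,dt.$$ For $r=\|v\|_\infty+1$ it has a representative in $C([0,T];L^2(\Omega))$ and $$\|z\|_{C([0,T];L^2(\Omega))}+\|z\|_{L^2(0,T;H^1_a(\Omega))}\le 2\big(\|p^0\|_{L^2(\Omega)}+\|f\|_{L^2(0,T;(H^1_a(\Omega))')}\big).$$ (3) For every $y^0\in L^2(\Omega)$ the state equation $$y_t-(a y_x)_x=v\chi_\omega y\ \text{in }Q,\qquad a y_x|_{x=\pm1}=0,\qquad y(0,\cdot)=y^0,$$ has a unique weak solution $y\in W_a(0,T)$ (in the sense of (1) with $f=0$). It has a representative in $C([0,T];L^2(\Omega))$ and $$\|y\|_{C([0,T];L^2(\Omega))}+\|y\|_{L^2(0,T;H^1_a(\Omega))}\le 2e^{(\|v\|_\infty+1)T}\|y^0\|_{L^2(\Omega)}.$$ -/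

import Mathlib

open MeasureTheory Set
open scoped ENNReal

noncomputable section

namespace DegenerateParabolic

/-- The assumptions on the diffusion coefficient: `a` is `C¹` on `[-1, 1]`, positive inside,
zero at the end points, and `x ↦ ∫₀ˣ ds / a(s)` is integrable on `(-1, 1)`. -/
structure IsDegenerateCoefficient (a : ℝ → ℝ) : Prop where
  contDiffOn : ContDiffOn ℝ 1 a (Icc (-1) 1)
  pos : ∀ x ∈ Ioo (-1 : ℝ) 1, 0 < a x
  left_eq_zero : a (-1) = 0
  right_eq_zero : a 1 = 0
  integrable_primitive :
    IntegrableOn (fun x : ℝ => ∫ s in (0 : ℝ)..x, 1 / a s) (Ioo (-1) 1) volume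

/-- Lebesgue measure on `Ω = (-1, 1)`. -/
abbrev volΩ : Measure ℝ := volume.restrict (Ioo (-1 : ℝ) 1)

/-- Lebesgue measure on the time interval `(0, T)`. -/
abbrev volTime (T : ℝ) : Measure ℝ := volume.restrict (Ioo (0 : ℝ) T)

/-- The space `L²(Ω)`. -/
abbrev L2Ω : Type := Lp ℝ 2 volΩ

/-- The Bochner space `L²((0,T); E)`. -/
abbrev L2Time (T : ℝ) (E : Type) [NormedAddCommGroup E] : Type := Lp E 2 (volTime T)

/-- The space `L^∞(ω_T)`, where `ω_T = (0,T) × ω`. -/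
abbrev LInfControl (T : ℝ) (ω : Set ℝ) : Type :=
  Lp ℝ ∞ ((volume : Measure (ℝ × ℝ)).restrict (Ioo (0 : ℝ) T ×ˢ ω))

/-- Local absolute continuity in `Ω = (-1, 1)`. -/
def IsLocAbsCont (w : ℝ → ℝ) : Prop :=
  ∀ c d : ℝ, -1 < c → c ≤ d → d < 1 → AbsolutelyContinuousOnInterval w c d

theorem IsLocAbsCont.ae_differentiableAt {w : ℝ → ℝ} (hw : IsLocAbsCont w) :
    ∀ᵐ x ∂volΩ, DifferentiableAt ℝ w x := by
  rw [ae_restrict_iff' measurableSet_Ioo]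
  have key : ∀ n : ℕ, ∀ᵐ x : ℝ, x ∈ uIcc (-1 + 1 / ((n : ℝ) + 1)) (1 - 1 / ((n : ℝ) + 1)) →
      DifferentiableAt ℝ w x := by
    intro n
    have hn : (0 : ℝ) < 1 / ((n : ℝ) + 1) := by positivity
    have hn1 : 1 / ((n : ℝ) + 1) ≤ 1 := by
      rw [div_le_one (by positivity)]
      have : (0 : ℝ) ≤ n := n.cast_nonneg
      linarith
    exact (hw _ _ (by linarith) (by linarith) (by linarith)).ae_differentiableAt
  filter_upwards [ae_all_iff.2 key] with x hx hxm
  obtain ⟨n, hn⟩ := exists_nat_one_div_lt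
    (show (0 : ℝ) < min (x + 1) (1 - x) from
      lt_min (by linarith [hxm.1]) (by linarith [hxm.2]))
  have h1 := hn.trans_le (min_le_left _ _)
  have h2 := hn.trans_le (min_le_right _ _)
  refine hx n ?_
  rw [uIcc_of_le (by linarith)]
  exact ⟨by linarith, by linarith⟩

/-- The weighted Sobolev space `H¹_a(Ω)`. An element `u` is stored as the pair
`(u, √a u_x) ∈ L²(Ω) × L²(Ω)`, where `u` has a locally absolutely continuous representative `w`
and `u_x = w'` almost everywhere. Since the second entry is determined by the first, this is the
usual space; the norm inherited from the Hilbert product is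
`‖u‖² = ‖u‖²_{L²(Ω)} + ‖√a u_x‖²_{L²(Ω)}`. -/
def H1a (a : ℝ → ℝ) : Submodule ℝ (WithLp 2 (L2Ω × L2Ω)) where
  carrier := {U | ∃ w : ℝ → ℝ, IsLocAbsCont w ∧ (U.fst : ℝ → ℝ) =ᵐ[volΩ] w ∧
    (U.snd : ℝ → ℝ) =ᵐ[volΩ] fun x => √(a x) * deriv w x}
  zero_mem' := by
    refine ⟨0, fun c d _ _ _ => ?_, Lp.coeFn_zero _ _ _, ?_⟩
    · exact (LipschitzOnWith.of_dist_le_mul (K := 0) (by simp)).absolutelyContinuousOnInterval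
    · filter_upwards [Lp.coeFn_zero ℝ 2 volΩ] with x hx
      exact hx.trans (by simp)
  add_mem' := by
    rintro U V ⟨w, hw, h1, h2⟩ ⟨z, hz, k1, k2⟩
    refine ⟨w + z, fun c d hc hcd hd => (hw c d hc hcd hd).add (hz c d hc hcd hd), ?_, ?_⟩
    · filter_upwards [h1, k1, Lp.coeFn_add U.fst V.fst] with x e1 e2 e3
      exact e3.trans (by rw [Pi.add_apply, e1, e2, Pi.add_apply])
    · filter_upwards [h2, k2, Lp.coeFn_add U.snd V.snd, hw.ae_differentiableAt,
        hz.ae_differentiableAt] with x e1 e2 e3 d1 d2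
      exact e3.trans (by rw [Pi.add_apply, e1, e2, deriv_add d1 d2, mul_add])
  smul_mem' := by
    rintro r U ⟨w, hw, h1, h2⟩
    refine ⟨fun x => r * w x, fun c d hc hcd hd => (hw c d hc hcd hd).const_mul r, ?_, ?_⟩
    · filter_upwards [h1, Lp.coeFn_smul r U.fst] with x e1 e2
      exact e2.trans (by rw [Pi.smul_apply, e1, smul_eq_mul])
    · filter_upwards [h2, Lp.coeFn_smul r U.snd] with x e1 e2
      exact e2.trans (by simp [e1, mul_left_comm])

/-- The inclusion `H¹_a(Ω) → L²(Ω)`. -/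
def H1a.toL2 {a : ℝ → ℝ} : H1a a →L[ℝ] L2Ω :=
  (WithLp.fstL 2 ℝ L2Ω L2Ω).comp (H1a a).subtypeL

/-- The map `u ↦ √a u_x` from `H¹_a(Ω)` to `L²(Ω)`. -/
def H1a.weightedDeriv {a : ℝ → ℝ} : H1a a →L[ℝ] L2Ω :=
  (WithLp.sndL 2 ℝ L2Ω L2Ω).comp (H1a a).subtypeL

/-- The topological dual `(H¹_a(Ω))'` with the dual norm. -/
abbrev H1aDual (a : ℝ → ℝ) : Type := StrongDual ℝ (H1a a)

/-- The embedding `L²(Ω) → (H¹_a(Ω))'`, `y ↦ (ψ ↦ ∫_Ω y ψ dx)`. -/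
def L2Ω.toDual (a : ℝ → ℝ) (y : L2Ω) : H1aDual a := (innerSL ℝ y).comp H1a.toL2

/-- `g` is the derivative on `(0,T)` of the vector-valued function `u`, in the sense of
distributions with values in `E`. -/
def IsWeakTimeDeriv {E : Type} [NormedAddCommGroup E] [NormedSpace ℝ E] (T : ℝ)
    (u g : ℝ → E) : Prop :=
  ∀ θ : ℝ → ℝ, ContDiff ℝ ((⊤ : ℕ∞) : WithTop ℕ∞) θ → HasCompactSupport θ → tsupport θ ⊆ Ioo 0 T →
    ∫ t in Ioo 0 T, deriv θ t • u t = -∫ t in Ioo 0 T, θ t • g t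

/-- The space `W_a(0,T)` of all `ρ ∈ L²((0,T); H¹_a(Ω))` with `ρ_t ∈ L²((0,T); (H¹_a(Ω))')`. -/
def Wa (a : ℝ → ℝ) (T : ℝ) : Set (L2Time T (H1a a)) :=
  {ρ | ∃ g : L2Time T (H1aDual a),
    IsWeakTimeDeriv T (fun t => L2Ω.toDual a (H1a.toL2 (ρ t))) (fun t => g t)}

/-- `P ∈ C([0,T]; L²(Ω))` is the continuous representative of `ρ ∈ L²((0,T); H¹_a(Ω))`. -/
def IsContRep {a : ℝ → ℝ} {T : ℝ} (ρ : L2Time T (H1a a)) (P : C(Icc (0 : ℝ) T, L2Ω)) : Prop :=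
  ∀ᵐ t ∂volTime T, ∀ ht : t ∈ Icc (0 : ℝ) T, P ⟨t, ht⟩ = H1a.toL2 (ρ t)

/-- The test space `H(Q)`: functions `φ ∈ L²((0,T); H¹_a(Ω))` with `φ_t ∈ L²(Q)`
(and `L²(Q) = L²((0,T); L²(Ω))`) and `φ(T, ·) = 0`. An element is recorded together with its
derivative `φ_t` and its continuous representative in `C([0,T]; L²(Ω))`, both of which are
uniquely determined by `φ`; the values at `t = 0` and `t = T` are those of the latter. -/
structure TestFunction (a : ℝ → ℝ) (T : ℝ) (hT : 0 < T) where
  /-- the function `φ` -/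
  toFun : L2Time T (H1a a)
  /-- the derivative `φ_t` -/
  timeDeriv : L2Time T L2Ω
  /-- the continuous representative of `φ` -/
  rep : C(Icc (0 : ℝ) T, L2Ω)
  isWeakTimeDeriv : IsWeakTimeDeriv T (fun t => H1a.toL2 (toFun t)) (fun t => timeDeriv t)
  isContRep : IsContRep toFun rep
  final_eq_zero : rep ⟨T, right_mem_Icc.2 hT.le⟩ = 0

/-- The initial value `φ(0, ·)` of a test function. -/
def TestFunction.initial {a : ℝ → ℝ} {T : ℝ} {hT : 0 < T} (φ : TestFunction a T hT) : L2Ω :=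
  φ.rep ⟨0, left_mem_Icc.2 hT.le⟩

/-- `p ∈ W_a(0,T)` is a weak solution of `p_t - (a p_x)_x = v χ_ω p + f`, `a p_x = 0` at
`x = ±1`, `p(0) = p⁰`: for all `φ ∈ H(Q)`,
`-∫_Q φ_t p + ∫_Q a p_x φ_x - ∫_{ω_T} v p φ = ∫_Ω p⁰ φ(0) + ∫₀ᵀ ⟨f, φ⟩ dt`.
Integrals over `Q` and `ω_T` are written as iterated integrals, and the integral over `Ω` of a
product of two `L²` functions as their inner product; `a p_x φ_x = (√a p_x) (√a φ_x)`. -/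
def IsWeakSolution (a : ℝ → ℝ) {T : ℝ} (hT : 0 < T) (ω : Set ℝ) (f : L2Time T (H1aDual a))
    (v : LInfControl T ω) (p₀ : L2Ω) (p : L2Time T (H1a a)) : Prop :=
  p ∈ Wa a T ∧ ∀ φ : TestFunction a T hT,
    -(∫ t in Ioo 0 T, inner ℝ (φ.timeDeriv t) (H1a.toL2 (p t)))
      + (∫ t in Ioo 0 T, inner ℝ (H1a.weightedDeriv (p t)) (H1a.weightedDeriv (φ.toFun t)))
      - (∫ t in Ioo 0 T, ∫ x in ω, v (t, x) * H1a.toL2 (p t) x * H1a.toL2 (φ.toFun t) x)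
    = inner ℝ p₀ φ.initial + ∫ t in Ioo 0 T, f t (φ.toFun t)

/-- `z ∈ W_a(0,T)` is a weak solution of `z_t - (a z_x)_x + r z = v χ_ω z + e^{-rt} f`,
`a z_x = 0` at `x = ±1`, `z(0) = p⁰`: for all `φ ∈ H(Q)`,
`-∫_Q φ_t z + ∫_Q a z_x φ_x + r ∫_Q z φ - ∫_{ω_T} v z φ
  = ∫_Ω p⁰ φ(0) + ∫₀ᵀ e^{-rt} ⟨f, φ⟩ dt`. -/
def IsWeakSolutionDamped (a : ℝ → ℝ) {T : ℝ} (hT : 0 < T) (ω : Set ℝ) (r : ℝ)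
    (f : L2Time T (H1aDual a)) (v : LInfControl T ω) (p₀ : L2Ω) (z : L2Time T (H1a a)) : Prop :=
  z ∈ Wa a T ∧ ∀ φ : TestFunction a T hT,
    -(∫ t in Ioo 0 T, inner ℝ (φ.timeDeriv t) (H1a.toL2 (z t)))
      + (∫ t in Ioo 0 T, inner ℝ (H1a.weightedDeriv (z t)) (H1a.weightedDeriv (φ.toFun t)))
      + r * (∫ t in Ioo 0 T, inner ℝ (H1a.toL2 (z t)) (H1a.toL2 (φ.toFun t)))
      - (∫ t in Ioo 0 T, ∫ x in ω, v (t, x) * H1a.toL2 (z t) x * H1a.toL2 (φ.toFun t) x)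
    = inner ℝ p₀ φ.initial + ∫ t in Ioo 0 T, Real.exp (-r * t) * f t (φ.toFun t)

end DegenerateParabolic

end

/-!
The equation is treated in the Gelfand triple `H¹_a(Ω) ⊂ L²(Ω) ⊂ (H¹_a(Ω))'`. The degeneracy of `a`
enters only through three properties of the weighted space: `H¹_a(Ω)` is complete
(`completeSpace_H1a`), embeds injectively into `L²(Ω)` (`H1a.toL2_injective`), and is dense there
(`eq_zero_of_inner_toL2_eq_zero`). With `j u = u` and `S u = √a u_x` its norm is
`‖u‖² = ‖j u‖² + ‖S u‖²`, and the rest of the argument takes place for abstract Hilbert spaces `V`,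
`H` with maps `j, S : V → H` of this kind. Functionals on `V` are represented by elements of `V`,
and multiplication by `v χ_ω` becomes a bounded operator `M` on `L²(0,T;L²(Ω))` with
`∫₀ᵗ ⟨M y, y⟩ ≤ ‖v‖ ∫₀ᵗ ‖y‖²` (`exists_potential_operator`).

For `r = ‖v‖ + 1` the problem is coercive. Existence is Lions' projection theorem
(`exists_forall_inner_eq`, `exists_isWeakEvolution`): since test functions `φ` vanish at time `T`,
the operator `K` of the adjoint problem satisfies `⟨φ, K φ⟩ ≥ ‖φ‖² + ‖φ(0)‖² / 2`. Testing with
`θ(t) w` shows that a solution `z` has a weak derivative in `L²(0,T;V')`, and the energy identity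
`‖z(t)‖² = ‖z(0)‖² + 2 ∫₀ᵗ ⟨z_t, z⟩`, together with a representative in `C([0,T];H)`, is
`exists_continuous_rep_of_weakDeriv`. With `Λ = j† j`, the function `Λ z` is a primitive of its weak
derivative, and the product rule for `⟨(Λ + ε)⁻¹ Λ z, Λ z⟩` gives the identity as `ε → 0`, because
`(Λ + ε)⁻¹ Λ` tends to the identity. It follows that
`‖z(t)‖² + ∫₀ᵗ ‖z‖_V² ≤ ‖p⁰‖² + ‖F‖²`. Hence each of the two norms of `z` is at most
`‖p⁰‖ + ‖F‖`, which explains the factor `2`, and `z = 0` for zero data, which is uniqueness.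

If `z` solves the problem with parameter `r`, then `e^{(r - s)t} z` solves it with parameter `s`
(`IsDampedEvolution.exp_mul`). Well-posedness for all `r`, including the original equation `r = 0`,
follows from the coercive case, and the factor `e^{(‖v‖ + 1)T}` in the estimate for `r = 0` is the
supremum of the weight.
-/

noncomputable section

open Filter
open scoped Topology

namespace DegenerateParabolic

/-! ### Calculus for primitives of vector-valued functions -/

section

/-- Absolute continuity is inherited along a bound on increments. -/
theorem absolutelyContinuousOnInterval_of_norm_sub_le {E : Type*} [NormedAddCommGroup E]
    {f : ℝ → E} {g : ℝ → ℝ} {C a b : ℝ} (hC : 0 ≤ C) (hg : AbsolutelyContinuousOnInterval g a b)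
    (h : ∀ x ∈ uIcc a b, ∀ y ∈ uIcc a b, ‖f x - f y‖ ≤ C * |g x - g y|) :
    AbsolutelyContinuousOnInterval f a b := by
  rw [absolutelyContinuousOnInterval_iff] at hg ⊢
  intro ε hε
  obtain ⟨δ, hδ, H⟩ := hg (ε / (C + 1)) (by positivity)
  refine ⟨δ, hδ, fun I hI hlen => ?_⟩
  have h1 := H I hI hlen
  calc ∑ i ∈ Finset.range I.1, dist (f (I.2 i).1) (f (I.2 i).2)
      ≤ ∑ i ∈ Finset.range I.1, C * dist (g (I.2 i).1) (g (I.2 i).2) := by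
        refine Finset.sum_le_sum fun i hi => ?_
        rw [dist_eq_norm, Real.dist_eq]
        exact h _ (hI.1 i hi).1 _ (hI.1 i hi).2
    _ = C * ∑ i ∈ Finset.range I.1, dist (g (I.2 i).1) (g (I.2 i).2) := by rw [Finset.mul_sum]
    _ ≤ C * (ε / (C + 1)) := by gcongr
    _ < (C + 1) * (ε / (C + 1)) := by gcongr; linarith
    _ = ε := by field_simp

theorem continuousOn_const_add_primitive {E : Type*} [NormedAddCommGroup E] [NormedSpace ℝ E]
    {h : ℝ → E} {a b : ℝ} (hh : IntervalIntegrable h volume a b) (c : E) :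
    ContinuousOn (fun t => c + ∫ s in a..t, h s) (uIcc a b) :=
  continuousOn_const.add (intervalIntegral.continuousOn_primitive_interval' hh left_mem_uIcc)

theorem norm_primitive_sub_le {E : Type*} [NormedAddCommGroup E] [NormedSpace ℝ E]
    {h : ℝ → E} {k : ℝ → ℝ} {a b : ℝ} (hh : IntervalIntegrable h volume a b)
    (hk : IntervalIntegrable k volume a b) (hhk : ∀ s, ‖h s‖ ≤ k s) (c : E)
    {x y : ℝ} (hx : x ∈ uIcc a b) (hy : y ∈ uIcc a b) :
    ‖(c + ∫ s in a..x, h s) - (c + ∫ s in a..y, h s)‖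
      ≤ |(∫ s in a..x, k s) - ∫ s in a..y, k s| := by
  have hsub : ∀ {z}, z ∈ uIcc a b → uIcc a z ⊆ uIcc a b := fun hz =>
    uIcc_subset_uIcc left_mem_uIcc hz
  have hsub' : uIcc y x ⊆ uIcc a b := uIcc_subset_uIcc hy hx
  rw [add_sub_add_left_eq_sub,
    intervalIntegral.integral_interval_sub_left (hh.mono_set (hsub hx)) (hh.mono_set (hsub hy)),
    intervalIntegral.integral_interval_sub_left (hk.mono_set (hsub hx)) (hk.mono_set (hsub hy))]
  exact intervalIntegral.norm_integral_le_abs_of_norm_le (Eventually.of_forall fun s => hhk s)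
    (hk.mono_set hsub')

/-- **Integration by parts** for a bounded bilinear map applied to two primitives of integrable
vector-valued functions. Both sides, as functions of the upper limit, are absolutely continuous
with the same derivative almost everywhere. -/
theorem bilin_primitive_eq_integral {E F G : Type*} [NormedAddCommGroup E] [NormedSpace ℝ E]
    [CompleteSpace E] [NormedAddCommGroup F] [NormedSpace ℝ F] [CompleteSpace F]
    [NormedAddCommGroup G] [NormedSpace ℝ G] [CompleteSpace G] (B : E →L[ℝ] F →L[ℝ] G)
    {h : ℝ → E} {k : ℝ → F} {a b : ℝ} (hh : IntervalIntegrable h volume a b)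
    (hk : IntervalIntegrable k volume a b) (c : E) (d : F) :
    IntervalIntegrable (fun t => B (h t) (d + ∫ s in a..t, k s)) volume a b ∧
    IntervalIntegrable (fun t => B (c + ∫ s in a..t, h s) (k t)) volume a b ∧
    B (c + ∫ s in a..b, h s) (d + ∫ s in a..b, k s) = B c d +
      ((∫ t in a..b, B (h t) (d + ∫ s in a..t, k s)) +
        ∫ t in a..b, B (c + ∫ s in a..t, h s) (k t)) := by
  set D : ℝ → E := fun t => c + ∫ s in a..t, h s with hD
  set K : ℝ → F := fun t => d + ∫ s in a..t, k s with hK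
  have hDc : ContinuousOn D (uIcc a b) := continuousOn_const_add_primitive hh c
  have hKc : ContinuousOn K (uIcc a b) := continuousOn_const_add_primitive hk d
  obtain ⟨C₁, hC₁⟩ := isCompact_uIcc.exists_bound_of_continuousOn hDc
  obtain ⟨C₂, hC₂⟩ := isCompact_uIcc.exists_bound_of_continuousOn hKc
  have hC₁0 : 0 ≤ C₁ := (norm_nonneg _).trans (hC₁ a left_mem_uIcc)
  have hC₂0 : 0 ≤ C₂ := (norm_nonneg _).trans (hC₂ a left_mem_uIcc)
  have hsub : uIoc a b ⊆ uIcc a b := uIoc_subset_uIcc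
  have i1 : IntervalIntegrable (fun t => B (h t) (K t)) volume a b := by
    refine (hh.norm.const_mul (‖B‖ * C₂)).mono_fun ?_ ?_
    · exact B.aestronglyMeasurable_comp₂ (intervalIntegrable_iff.1 hh).aestronglyMeasurable
        ((hKc.mono hsub).aestronglyMeasurable measurableSet_uIoc)
    · refine (ae_restrict_mem measurableSet_uIoc).mono fun t ht => ?_
      have h1 := hC₂ t (hsub ht)
      simp only
      rw [Real.norm_of_nonneg (by positivity)]
      calc ‖B (h t) (K t)‖ ≤ ‖B‖ * ‖h t‖ * ‖K t‖ := B.le_opNorm₂ _ _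
        _ ≤ ‖B‖ * ‖h t‖ * C₂ := by gcongr
        _ = ‖B‖ * C₂ * ‖h t‖ := by ring
  have i2 : IntervalIntegrable (fun t => B (D t) (k t)) volume a b := by
    refine (hk.norm.const_mul (‖B‖ * C₁)).mono_fun ?_ ?_
    · exact B.aestronglyMeasurable_comp₂ ((hDc.mono hsub).aestronglyMeasurable measurableSet_uIoc)
        (intervalIntegrable_iff.1 hk).aestronglyMeasurable
    · refine (ae_restrict_mem measurableSet_uIoc).mono fun t ht => ?_
      have h1 := hC₁ t (hsub ht)
      simp only
      rw [Real.norm_of_nonneg (by positivity)]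
      calc ‖B (D t) (k t)‖ ≤ ‖B‖ * ‖D t‖ * ‖k t‖ := B.le_opNorm₂ _ _
        _ ≤ ‖B‖ * C₁ * ‖k t‖ := by gcongr
  refine ⟨i1, i2, ?_⟩
  set m : ℝ → G := fun t => B (h t) (K t) + B (D t) (k t) with hm
  have im : IntervalIntegrable m volume a b := i1.add i2
  have iκ : IntervalIntegrable (fun t => ‖h t‖ + ‖k t‖ + ‖m t‖) volume a b :=
    (hh.norm.add hk.norm).add im.norm
  set g : ℝ → ℝ := fun x => ∫ s in a..x, ‖h s‖ + ‖k s‖ + ‖m s‖ with hg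
  have gac : AbsolutelyContinuousOnInterval g a b :=
    iκ.absolutelyContinuousOnInterval_intervalIntegral left_mem_uIcc
  set Φ : ℝ → G := fun t => B (D t) (K t) - ∫ s in a..t, m s with hΦ
  have Φac : AbsolutelyContinuousOnInterval Φ a b := by
    refine absolutelyContinuousOnInterval_of_norm_sub_le
      (C := ‖B‖ * C₂ + ‖B‖ * C₁ + 1) (by positivity) gac fun x hx y hy => ?_
    have e1 : ‖D x - D y‖ ≤ |g x - g y| := norm_primitive_sub_le hh iκ
      (fun s => by linarith [norm_nonneg (k s), norm_nonneg (m s)]) c hx hy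
    have e2 : ‖K x - K y‖ ≤ |g x - g y| := norm_primitive_sub_le hk iκ
      (fun s => by linarith [norm_nonneg (h s), norm_nonneg (m s)]) d hx hy
    have e3 : ‖(0 + ∫ s in a..x, m s) - (0 + ∫ s in a..y, m s)‖ ≤ |g x - g y| :=
      norm_primitive_sub_le im iκ (fun s => by linarith [norm_nonneg (k s), norm_nonneg (h s)])
        0 hx hy
    rw [zero_add, zero_add] at e3
    have e4 : Φ x - Φ y = B (D x - D y) (K x) + B (D y) (K x - K y)
        - ((∫ s in a..x, m s) - ∫ s in a..y, m s) := by
      simp only [hΦ, map_sub, sub_apply]; abel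
    rw [e4]
    refine (norm_sub_le _ _).trans ?_
    have e5 : ‖B (D x - D y) (K x)‖ ≤ ‖B‖ * |g x - g y| * C₂ :=
      (B.le_opNorm₂ _ _).trans (by gcongr; exact hC₂ x hx)
    have e6 : ‖B (D y) (K x - K y)‖ ≤ ‖B‖ * C₁ * |g x - g y| :=
      (B.le_opNorm₂ _ _).trans (by gcongr; exact hC₁ y hy)
    have e7 := norm_add_le (B (D x - D y) (K x)) (B (D y) (K x - K y))
    linarith
  have Φder : ∀ᵐ x, x ∈ uIcc a b → HasDerivAt Φ 0 x := by
    filter_upwards [hh.ae_hasDerivAt_integral, hk.ae_hasDerivAt_integral,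
      im.ae_hasDerivAt_integral] with x h1 h2 h3 hx
    have d1 : HasDerivAt D (h x) x := (h1 hx a left_mem_uIcc).const_add c
    have d2 : HasDerivAt K (k x) x := (h2 hx a left_mem_uIcc).const_add d
    have d3 := (B.hasFDerivAt_of_bilinear d1.hasFDerivAt d2.hasFDerivAt).hasDerivAt.sub
      (h3 hx a left_mem_uIcc)
    convert! d3 using 1
    simp [hm, add_comm]
  obtain ⟨C, hC⟩ := Φac.const_of_ae_hasDerivAt_zero Φder
  have q1 := hC a left_mem_uIcc
  have q2 := hC b right_mem_uIcc
  rw [← intervalIntegral.integral_add i1 i2]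
  have q3 : Φ a = B c d := by simp [hΦ, hD, hK]
  have q4 : Φ b = B (D b) (K b) - ∫ s in a..b, m s := rfl
  rw [← q3, q1, ← q2, q4]
  exact (sub_add_cancel _ _).symm

theorem intervalIntegrable_of_integrableOn_Ioo {E : Type*} [NormedAddCommGroup E] {h : ℝ → E}
    {T s t : ℝ} (hh : IntegrableOn h (Ioo 0 T)) (hs : s ∈ Icc 0 T) (ht : t ∈ Icc 0 T) :
    IntervalIntegrable h volume s t := by
  have h1 : IntegrableOn h (Icc 0 T) := by rwa [integrableOn_Icc_iff_integrableOn_Ioo]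
  rw [intervalIntegrable_iff]
  exact h1.mono_set (uIoc_subset_uIcc.trans (uIcc_subset_Icc hs ht))

theorem setIntegral_Ioo_eq_intervalIntegral {E : Type*} [NormedAddCommGroup E] [NormedSpace ℝ E]
    {T : ℝ} (hT : 0 ≤ T) (f : ℝ → E) : ∫ t in Ioo 0 T, f t = ∫ t in (0 : ℝ)..T, f t := by
  rw [intervalIntegral.integral_of_le hT, integral_Ioc_eq_integral_Ioo]

/-- Integration by parts against a scalar test function, boundary terms included. -/
theorem integral_deriv_smul_primitive {E : Type*} [NormedAddCommGroup E] [NormedSpace ℝ E]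
    [CompleteSpace E] {T : ℝ} (hT : 0 ≤ T) {h : ℝ → E} (hh : IntegrableOn h (Ioo 0 T)) (c : E)
    {θ : ℝ → ℝ} (hθ : ContDiff ℝ 1 θ) :
    (∫ t in Ioo 0 T, deriv θ t • (c + ∫ s in (0 : ℝ)..t, h s)) + ∫ t in Ioo 0 T, θ t • h t
      = θ T • (c + ∫ s in (0 : ℝ)..T, h s) - θ 0 • c := by
  have hI := intervalIntegrable_of_integrableOn_Ioo hh (left_mem_Icc.2 hT) (right_mem_Icc.2 hT)
  have hd : Continuous (deriv θ) := hθ.continuous_deriv le_rfl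
  have hθt : ∀ t, θ 0 + ∫ s in (0 : ℝ)..t, deriv θ s = θ t := fun t => by
    rw [intervalIntegral.integral_deriv_eq_sub (fun x _ => hθ.differentiable one_ne_zero x)
      (hd.intervalIntegrable _ _)]
    ring
  obtain ⟨-, -, key⟩ := bilin_primitive_eq_integral (ContinuousLinearMap.lsmul ℝ ℝ : ℝ →L[ℝ] E →L[ℝ] E)
    (hd.intervalIntegrable 0 T) hI (θ 0) c
  simp only [hθt, ContinuousLinearMap.lsmul_apply] at key
  rw [setIntegral_Ioo_eq_intervalIntegral hT, setIntegral_Ioo_eq_intervalIntegral hT, key]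
  abel

theorem exists_Icc_of_isCompact_subset_Ioo {T : ℝ} {K : Set ℝ} (hT : 0 < T) (hK : IsCompact K)
    (hKT : K ⊆ Ioo 0 T) : ∃ α β, 0 < α ∧ β < T ∧ K ⊆ Icc α β := by
  rcases K.eq_empty_or_nonempty with rfl | hne
  · exact ⟨T, 0, hT, hT, empty_subset _⟩
  · exact ⟨sInf K, sSup K, (hKT (hK.sInf_mem hne)).1, (hKT (hK.sSup_mem hne)).2, fun x hx =>
      ⟨csInf_le hK.bddBelow hx, le_csSup hK.bddAbove hx⟩⟩

/-- **Lemma of du Bois-Reymond**: a function with an integrable weak derivative is a primitive of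
that derivative. -/
theorem IsWeakTimeDeriv.exists_eq_primitive {E : Type} [NormedAddCommGroup E] [NormedSpace ℝ E]
    [CompleteSpace E] {T : ℝ} (hT : 0 < T) {u h : ℝ → E} (hu : IntegrableOn u (Ioo 0 T))
    (hh : IntegrableOn h (Ioo 0 T)) (huh : IsWeakTimeDeriv T u h) :
    ∃ c : E, ∀ᵐ t ∂volTime T, u t = c + ∫ s in (0 : ℝ)..t, h s := by
  set D : ℝ → E := fun t => ∫ s in (0 : ℝ)..t, h s with hD
  have hDc : ContinuousOn D (Icc 0 T) := by
    have := continuousOn_const_add_primitive (intervalIntegrable_of_integrableOn_Ioo hh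
      (left_mem_Icc.2 hT.le) (right_mem_Icc.2 hT.le)) 0
    simpa [uIcc_of_le hT.le] using this
  have hDi : IntegrableOn D (Ioo 0 T) :=
    (hDc.integrableOn_compact isCompact_Icc).mono_set Ioo_subset_Icc_self
  set w : ℝ → E := u - D with hw
  have hwi : IntegrableOn w (Ioo 0 T) := hu.sub hDi
  have smul_int : ∀ {f : ℝ → E} {θ : ℝ → ℝ}, IntegrableOn f (Ioo 0 T) → Continuous θ →
      IntegrableOn (fun t => θ t • f t) (Ioo 0 T) := fun {f θ} hf hθ => by
    have hf' : IntegrableOn f (Icc 0 T) := by rwa [integrableOn_Icc_iff_integrableOn_Ioo]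
    exact (hf'.continuousOn_smul hθ.continuousOn isCompact_Icc).mono_set Ioo_subset_Icc_self
  have hw0 : ∀ θ : ℝ → ℝ, ContDiff ℝ ((⊤ : ℕ∞) : WithTop ℕ∞) θ → HasCompactSupport θ →
      tsupport θ ⊆ Ioo 0 T → ∫ t in Ioo 0 T, deriv θ t • w t = 0 := by
    intro θ h1 h2 h3
    have hθ1 : ContDiff ℝ 1 θ := h1.of_le (by exact_mod_cast le_top)
    have z0 : θ 0 = 0 := image_eq_zero_of_notMem_tsupport fun h => (h3 h).1.false
    have zT : θ T = 0 := image_eq_zero_of_notMem_tsupport fun h => (h3 h).2.false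
    have e1 := integral_deriv_smul_primitive hT.le hh 0 hθ1
    have e2 := huh θ h1 h2 h3
    have hd := hθ1.continuous_deriv le_rfl
    simp only [z0, zT, zero_add, zero_smul, sub_zero] at e1
    simp only [hw, Pi.sub_apply, smul_sub]
    rw [integral_sub (smul_int hu hd) (smul_int hDi hd), e2, eq_neg_of_add_eq_zero_left e1]
    abel
  -- a bump function of unit mass
  let bump : ContDiffBump (T / 2 : ℝ) := ⟨T / 8, T / 4, by positivity, by linarith⟩
  set η : ℝ → ℝ := bump.normed volume with hη
  have η1 : ContDiff ℝ ((⊤ : ℕ∞) : WithTop ℕ∞) η := bump.contDiff_normed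
  have η2 : HasCompactSupport η := bump.hasCompactSupport_normed
  have η3 : tsupport η ⊆ Ioo 0 T := by
    rw [hη, bump.tsupport_normed_eq, Real.closedBall_eq_Icc]
    refine Icc_subset_Ioo ?_ ?_ <;> simp only [bump] <;> linarith
  have set_eq : ∀ {F : Type} [NormedAddCommGroup F] [NormedSpace ℝ F] {θ : ℝ → ℝ} {f : ℝ → F},
      tsupport θ ⊆ Ioo 0 T → ∫ t, θ t • f t = ∫ t in Ioo 0 T, θ t • f t := fun {F _ _ θ f} hθ =>
    (setIntegral_eq_integral_of_forall_compl_eq_zero fun t ht => by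
      rw [image_eq_zero_of_notMem_tsupport fun h => ht (hθ h), zero_smul]).symm
  have η4 : ∫ t, η t = 1 := bump.integral_normed
  refine ⟨∫ t in Ioo 0 T, η t • w t, ?_⟩
  set c : E := ∫ t in Ioo 0 T, η t • w t with hc
  have hwc : IntegrableOn (fun t => w t - c) (Ioo 0 T) := hwi.sub (by simp)
  have main := isOpen_Ioo.ae_eq_zero_of_integral_contDiff_smul_eq_zero (μ := volume)
    hwc.locallyIntegrableOn fun ψ ψ1 ψ2 ψ3 => by
    have ψi : Integrable ψ := ψ1.continuous.integrable_of_hasCompactSupport ψ2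
    have ηi : Integrable η := η1.continuous.integrable_of_hasCompactSupport η2
    set I : ℝ := ∫ t, ψ t with hI
    -- the mean-free function `ψ - I η` has a primitive which is again a test function
    set q : ℝ → ℝ := fun t => ψ t - I * η t with hq
    have qi : Integrable q := ψi.sub (ηi.const_mul I)
    have q1 : ContDiff ℝ ((⊤ : ℕ∞) : WithTop ℕ∞) q := ψ1.sub (contDiff_const.mul η1)
    have qint : ∫ t, q t = 0 := by
      rw [integral_sub ψi (ηi.const_mul I), integral_const_mul, η4]; simp [hI]
    obtain ⟨α, β, hα, hβ, hK⟩ := exists_Icc_of_isCompact_subset_Ioo hT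
      (ψ2.isCompact.union η2.isCompact) (union_subset ψ3 η3)
    have qz : ∀ t, t ∉ Icc α β → q t = 0 := fun t ht => by
      have a1 : ψ t = 0 := image_eq_zero_of_notMem_tsupport fun h => ht (hK (Or.inl h))
      have a2 : η t = 0 := image_eq_zero_of_notMem_tsupport fun h => ht (hK (Or.inr h))
      simp [hq, a1, a2]
    set θ : ℝ → ℝ := fun t => ∫ s in (0 : ℝ)..t, q s with hθ
    have θd : ∀ t, HasDerivAt θ (q t) t := fun t =>
      intervalIntegral.integral_hasDerivAt_right (q1.continuous.intervalIntegrable _ _)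
        q1.continuous.stronglyMeasurable.stronglyMeasurableAtFilter q1.continuous.continuousAt
    have θd' : deriv θ = q := funext fun t => (θd t).deriv
    have θ1 : ContDiff ℝ ((⊤ : ℕ∞) : WithTop ℕ∞) θ := by
      rw [contDiff_infty_iff_deriv, θd']
      exact ⟨fun t => (θd t).differentiableAt, q1⟩
    have θz : ∀ t, t ∉ Icc α β → θ t = 0 := by
      intro t ht
      rw [mem_Icc, not_and_or, not_le, not_le] at ht
      rcases ht with ht | ht
      · refine intervalIntegral.integral_zero_ae (Eventually.of_forall fun s hs => qz s fun h => ?_)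
        have := hs.2.trans (max_le hα.le ht.le)
        rcases le_total 0 t with h0 | h0
        · rw [uIoc_of_le h0] at hs; linarith [hs.2, h.1]
        · rw [uIoc_of_ge h0] at hs; linarith [hs.2, h.1]
      · by_cases hαβ : α ≤ β
        · have h0 : 0 ≤ t := by linarith
          have : θ t = ∫ s, q s := by
            rw [hθ]; simp only
            rw [intervalIntegral.integral_of_le h0]
            refine setIntegral_eq_integral_of_forall_compl_eq_zero fun s hs => qz s fun h => hs ?_
            exact ⟨by linarith [h.1], by linarith [h.2]⟩
          rw [this, qint]
        · refine intervalIntegral.integral_zero_ae (Eventually.of_forall fun s hs => qz s fun h => ?_)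
          exact hαβ (h.1.trans h.2)
    have θts : tsupport θ ⊆ Icc α β :=
      closure_minimal (fun t ht => by_contra fun h => ht (θz t h)) isClosed_Icc
    have θ3 : tsupport θ ⊆ Ioo 0 T := θts.trans (Icc_subset_Ioo hα hβ)
    have θ2 : HasCompactSupport θ := isCompact_Icc.of_isClosed_subset (isClosed_tsupport θ) θts
    have e := hw0 θ θ1 θ2 θ3
    rw [θd'] at e
    simp only [hq, sub_smul, mul_smul] at e
    have ηw : IntegrableOn (fun t => I • η t • w t) (Ioo 0 T) := (smul_int hwi η1.continuous).smul I
    rw [integral_sub (smul_int hwi ψ1.continuous) ηw, integral_smul, ← hc, sub_eq_zero] at e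
    have ψc : IntegrableOn (fun t => ψ t • c) (Ioo 0 T) := ψi.integrableOn.smul_const c
    rw [set_eq ψ3]
    simp only [smul_sub]
    rw [integral_sub (smul_int hwi ψ1.continuous) ψc, e, ← set_eq ψ3, integral_smul_const, sub_self]
  rw [ae_restrict_iff' measurableSet_Ioo]
  filter_upwards [main] with t ht hmem
  have := ht hmem
  simp only [hw, Pi.sub_apply] at this
  rw [← sub_eq_zero, ← this]; abel

end

/-! ### The energy identity in a Gelfand triple -/

section

/-- An injective positive symmetric operator `Λ` has approximate inverses `(Λ + ε)⁻¹`: they are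
symmetric, and `(Λ + ε)⁻¹ Λ` is a contraction that tends strongly to the identity as `ε → 0`. -/
theorem exists_approximate_inverse {V : Type*} [NormedAddCommGroup V] [InnerProductSpace ℝ V]
    [CompleteSpace V] (Λ : V →L[ℝ] V) (hsymm : ∀ x y, inner ℝ (Λ x) y = inner ℝ x (Λ y))
    (hpos : ∀ x, 0 ≤ inner ℝ (Λ x) x) (hinj : ∀ x, Λ x = 0 → x = 0) :
    ∃ R : ℕ → V →L[ℝ] V, (∀ n x y, inner ℝ (R n x) y = inner ℝ x (R n y)) ∧
      (∀ n x, ‖R n (Λ x)‖ ≤ ‖x‖) ∧ ∀ x, Tendsto (fun n => R n (Λ x)) atTop (𝓝 x) := by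
  set ε : ℕ → ℝ := fun n => 1 / ((n : ℝ) + 1) with hε
  have ε0 : ∀ n, 0 < ε n := fun n => by positivity
  have hA : ∀ n, ∃ A : V ≃L[ℝ] V, ∀ x, A x = Λ x + ε n • x := by
    intro n
    set B : V →L[ℝ] V →L[ℝ] ℝ := (innerSL ℝ).comp (Λ + ε n • ContinuousLinearMap.id ℝ V) with hB
    have hB' : ∀ x y, B x y = inner ℝ (Λ x + ε n • x) y := fun x y => rfl
    have hc : IsCoercive B := ⟨ε n, ε0 n, fun x => by
      rw [hB', inner_add_left, real_inner_smul_left, real_inner_self_eq_norm_sq]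
      nlinarith [hpos x]⟩
    refine ⟨hc.continuousLinearEquivOfBilin, fun x => ext_inner_right ℝ fun y => ?_⟩
    rw [hc.continuousLinearEquivOfBilin_apply, hB']
  choose A hA using hA
  have hAR : ∀ n x, Λ ((A n).symm x) + ε n • (A n).symm x = x := fun n x => by
    rw [← hA, (A n).apply_symm_apply]
  have hbd : ∀ n x, ‖(A n).symm (Λ x)‖ ≤ ‖x‖ := by
    intro n x
    set y := (A n).symm (Λ x)
    have h1 : Λ (x - y) = ε n • y := by rw [map_sub, sub_eq_iff_eq_add', hAR]
    have h2 := hpos (x - y)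
    rw [h1, real_inner_smul_left, inner_sub_right, real_inner_self_eq_norm_sq] at h2
    have h3 := nonneg_of_mul_nonneg_right h2 (ε0 n)
    have h4 := real_inner_le_norm y x
    by_contra hlt
    push Not at hlt
    nlinarith [norm_nonneg x, norm_nonneg y]
  refine ⟨fun n => ((A n).symm : V →L[ℝ] V), fun n x y => ?_, hbd, fun x => ?_⟩
  · change inner ℝ ((A n).symm x) y = inner ℝ x ((A n).symm y)
    nth_rewrite 1 [← hAR n y]
    nth_rewrite 2 [← hAR n x]
    rw [inner_add_left, inner_add_right, hsymm, real_inner_smul_left, real_inner_smul_right]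
  · have hdense : Dense (Set.range Λ) := by
      have : (Λ.range)ᗮ = ⊥ := by
        rw [Submodule.eq_bot_iff]
        intro w hw
        refine hinj w (ext_inner_left ℝ fun v => ?_)
        rw [← hsymm, inner_zero_right]
        exact hw _ ⟨v, rfl⟩
      have h2 := Submodule.dense_iff_topologicalClosure_eq_top.2
        ((Submodule.topologicalClosure_eq_top_iff (K := Λ.range)).2 this)
      exact h2
    rw [Metric.tendsto_atTop]
    intro δ hδ
    obtain ⟨_, hz, ⟨z, rfl⟩⟩ := Metric.dense_iff.1 hdense x (δ / 4) (by positivity)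
    have hz' : ‖x - Λ z‖ < δ / 4 := by
      rw [← dist_eq_norm, dist_comm]; exact hz
    have hlim : Tendsto (fun n => ε n * ‖z‖) atTop (𝓝 0) := by
      simpa only [zero_mul] using tendsto_one_div_add_atTop_nhds_zero_nat.mul_const ‖z‖
    obtain ⟨N, hN⟩ := (hlim.eventually_lt_const (show (0 : ℝ) < δ / 4 by positivity)).exists_forall_of_atTop
    refine ⟨N, fun n hn => ?_⟩
    have e1 := hbd n (x - Λ z)
    -- on the range of `Λ` the error is `ε (Λ + ε)⁻¹ Λ z`
    have e2 : Λ z - (A n).symm (Λ (Λ z)) = ε n • (A n).symm (Λ z) := by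
      rw [sub_eq_iff_eq_add, ← map_smul, ← map_add, eq_comm, ContinuousLinearEquiv.symm_apply_eq,
        hA, add_comm]
    have e3 : ‖Λ z - (A n).symm (Λ (Λ z))‖ ≤ ε n * ‖z‖ := by
      rw [e2, norm_smul, Real.norm_of_nonneg (ε0 n).le]
      exact mul_le_mul_of_nonneg_left (hbd n z) (ε0 n).le
    have e4 : (A n).symm (Λ x) - x = (A n).symm (Λ (x - Λ z))
        - (Λ z - (A n).symm (Λ (Λ z))) - (x - Λ z) := by
      simp only [map_sub]; abel
    rw [dist_eq_norm]
    change ‖(A n).symm (Λ x) - x‖ < δ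
    rw [e4]
    have e5 := norm_sub_le ((A n).symm (Λ (x - Λ z)) - (Λ z - (A n).symm (Λ (Λ z)))) (x - Λ z)
    have e6 := norm_sub_le ((A n).symm (Λ (x - Λ z))) (Λ z - (A n).symm (Λ (Λ z)))
    have e7 := hN n hn
    linarith

theorem dense_setOf_mem_Icc_of_ae {T : ℝ} (hT : 0 < T) {p : ℝ → Prop}
    (hp : ∀ᵐ t ∂volTime T, p t) : Dense {t : Icc (0 : ℝ) T | (t : ℝ) ∈ Ioo 0 T ∧ p t} := by
  rw [ae_restrict_iff' measurableSet_Ioo] at hp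
  have hd := Measure.dense_of_ae hp
  rw [Metric.dense_iff]
  rintro ⟨t, ht⟩ ε hε
  have hlt : max 0 (t - ε) < min T (t + ε) :=
    max_lt (lt_min hT (by linarith [ht.1])) (lt_min (by linarith [ht.2]) (by linarith))
  obtain ⟨s, hs, hsp⟩ := hd.inter_open_nonempty _ isOpen_Ioo (nonempty_Ioo.2 hlt)
  have h1 : s ∈ Ioo 0 T := ⟨(le_max_left _ _).trans_lt hs.1, hs.2.trans_le (min_le_left _ _)⟩
  refine ⟨⟨s, Ioo_subset_Icc_self h1⟩, ?_, h1, hsp h1⟩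
  rw [Metric.mem_ball, Subtype.dist_eq, Real.dist_eq, abs_lt]
  exact ⟨by linarith [(le_max_right 0 (t - ε)).trans_lt hs.1],
    by linarith [hs.2.trans_le (min_le_right T (t + ε))]⟩

variable {V H : Type} [NormedAddCommGroup V] [InnerProductSpace ℝ V] [NormedAddCommGroup H]
  [InnerProductSpace ℝ H] [CompleteSpace H]

open ContinuousLinearMap (adjoint)

theorem integrableOn_inner_of_memLp {T : ℝ} {u h : ℝ → V} (hu : MemLp u 2 (volTime T))
    (hh : MemLp h 2 (volTime T)) : IntegrableOn (fun t => inner ℝ (h t) (u t)) (Ioo 0 T) := by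
  have := L2.integrable_inner (𝕜 := ℝ) (hh.toLp h) (hu.toLp u)
  refine this.congr ?_
  filter_upwards [hu.coeFn_toLp, hh.coeFn_toLp] with t h1 h2
  rw [h1, h2]

variable [CompleteSpace V]

/-- The energy identity between two times at which `j† j u` agrees with the primitive of its weak
derivative `h`: apply the product rule to `⟨(Λ + ε)⁻¹ Λ u, Λ u⟩` with `Λ = j† j`, and let
`ε → 0`. -/
theorem norm_sq_sub_norm_sq_eq_integral (j : V →L[ℝ] H) (hj : Function.Injective j) {T : ℝ}
    (hT : 0 < T) {u h : ℝ → V} (hu : MemLp u 2 (volTime T)) (hh : MemLp h 2 (volTime T)) (c : V)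
    (hc : ∀ᵐ t ∂volTime T, adjoint j (j (u t)) = c + ∫ s in (0 : ℝ)..t, h s)
    {s t : ℝ} (hs : s ∈ Icc 0 T) (ht : t ∈ Icc 0 T)
    (hcs : adjoint j (j (u s)) = c + ∫ s in (0 : ℝ)..s, h s)
    (hct : adjoint j (j (u t)) = c + ∫ s in (0 : ℝ)..t, h s) :
    ‖j (u t)‖ ^ 2 - ‖j (u s)‖ ^ 2 = 2 * ((∫ τ in (0 : ℝ)..t, inner ℝ (h τ) (u τ))
      - ∫ τ in (0 : ℝ)..s, inner ℝ (h τ) (u τ)) := by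
  have hhi : IntegrableOn h (Ioo 0 T) := hh.integrable (by norm_num)
  have hI := integrableOn_inner_of_memLp hu hh
  have hb := integrableOn_inner_of_memLp hu.norm hh.norm
  set Λ : V →L[ℝ] V := (adjoint j).comp j with hΛ
  have hΛin : ∀ x y, inner ℝ (Λ x) y = inner ℝ (j x) (j y) := fun x y =>
    ContinuousLinearMap.adjoint_inner_left j _ _
  obtain ⟨R, Rsymm, Rle, Rlim⟩ := exists_approximate_inverse Λ
    (fun x y => by rw [hΛin, real_inner_comm _ x, hΛin, real_inner_comm])
    (fun x => by rw [hΛin]; exact real_inner_self_nonneg) (fun x hx => by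
      have h1 : inner ℝ (j x) (j x) = 0 := by rw [← hΛin, hx, inner_zero_left]
      exact hj (by rw [inner_self_eq_zero.1 h1, map_zero]))
  set D : ℝ → V := fun t => c + ∫ s in (0 : ℝ)..t, h s with hD
  have zero_mem : (0 : ℝ) ∈ Icc 0 T := left_mem_Icc.2 hT.le
  have hN : ∀ n, ∀ x ∈ Icc 0 T, inner ℝ (R n (D x)) (D x)
      = inner ℝ (R n c) c + 2 * ∫ τ in (0 : ℝ)..x, inner ℝ (R n (D τ)) (h τ) := by
    intro n x hx
    have hix := intervalIntegrable_of_integrableOn_Ioo hhi zero_mem hx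
    obtain ⟨-, -, key⟩ := bilin_primitive_eq_integral ((innerSL ℝ).comp (R n)) hix hix c c
    simp only [ContinuousLinearMap.comp_apply, innerSL_apply_apply] at key
    rw [key, two_mul]
    congr 2
    refine intervalIntegral.integral_congr fun τ _ => ?_
    exact (Rsymm n _ _).trans (real_inner_comm _ _)
  have hlim : ∀ x ∈ Icc 0 T, Tendsto (fun n => ∫ τ in (0 : ℝ)..x, inner ℝ (R n (D τ)) (h τ)) atTop
      (𝓝 (∫ τ in (0 : ℝ)..x, inner ℝ (h τ) (u τ))) := by
    intro x hx
    have hIoc : ∀ᵐ τ, τ ∈ uIoc 0 x → Λ (u τ) = D τ := by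
      rw [ae_restrict_iff' measurableSet_Ioo] at hc
      have hne : ∀ᵐ τ : ℝ, τ ≠ T := by simp [ae_iff, measure_singleton]
      filter_upwards [hc, hne] with τ h1 h2 h3
      rw [uIoc_of_le hx.1] at h3
      exact h1 ⟨h3.1, lt_of_le_of_ne (h3.2.trans hx.2) h2⟩
    have hDc : ContinuousOn D (uIcc 0 x) := continuousOn_const_add_primitive
      (intervalIntegrable_of_integrableOn_Ioo hhi zero_mem hx) c
    refine intervalIntegral.tendsto_integral_filter_of_dominated_convergence
      (fun τ => inner ℝ (‖h τ‖) (‖u τ‖)) (Eventually.of_forall fun n => ?_)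
      (Eventually.of_forall fun n => ?_) (intervalIntegrable_of_integrableOn_Ioo hb zero_mem hx) ?_
    · exact (((R n).continuous.comp_continuousOn hDc).mono uIoc_subset_uIcc
        |>.aestronglyMeasurable measurableSet_uIoc).inner (intervalIntegrable_iff.1
          (intervalIntegrable_of_integrableOn_Ioo hhi zero_mem hx)).aestronglyMeasurable
    · filter_upwards [hIoc] with τ h1 h2
      rw [← h1 h2]
      refine (norm_inner_le_norm _ _).trans ?_
      rw [real_inner_eq_re_inner, RCLike.inner_apply]
      simp only [conj_trivial, RCLike.re_to_real]
      exact mul_le_mul_of_nonneg_right (Rle n _) (norm_nonneg _)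
    · filter_upwards [hIoc] with τ h1 h2
      rw [← h1 h2, real_inner_comm (u τ)]
      exact (Rlim _).inner tendsto_const_nhds
  have hE : ∀ x, Λ (u x) = D x → Tendsto (fun n => inner ℝ (R n (D x)) (D x)) atTop
      (𝓝 (‖j (u x)‖ ^ 2)) := by
    intro x hx
    rw [← real_inner_self_eq_norm_sq, ← hΛin, real_inner_comm, ← hx]
    exact (Rlim _).inner tendsto_const_nhds
  have l1 := (hE t hct).sub (hE s hcs)
  have l2 := ((hlim t ht).sub (hlim s hs)).const_mul 2
  refine tendsto_nhds_unique l1 (l2.congr fun n => ?_)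
  rw [hN n t ht, hN n s hs]
  ring

/-- Increments of `j u` are controlled by the increments of `∫ ‖h‖² + 4‖u‖²`: between two given
times there is a third one, `r`, at which `‖u(r)‖²` does not exceed its mean, and
`‖j u(x) - j u(r)‖² = 2 ∫ ⟨h, u - u(r)⟩`. -/
theorem norm_sub_sq_le_of_weakDeriv (j : V →L[ℝ] H) (hj : Function.Injective j) {T : ℝ}
    (hT : 0 < T) {u h : ℝ → V} (hu : MemLp u 2 (volTime T)) (hh : MemLp h 2 (volTime T)) (c : V)
    (hc : ∀ᵐ t ∂volTime T, adjoint j (j (u t)) = c + ∫ s in (0 : ℝ)..t, h s)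
    {s t : ℝ} (hs : s ∈ Icc 0 T) (ht : t ∈ Icc 0 T) (hst : s < t)
    (hcs : adjoint j (j (u s)) = c + ∫ s in (0 : ℝ)..s, h s)
    (hct : adjoint j (j (u t)) = c + ∫ s in (0 : ℝ)..t, h s) :
    ‖j (u t) - j (u s)‖ ^ 2 ≤ 4 * ∫ τ in s..t, ‖h τ‖ ^ 2 + 4 * ‖u τ‖ ^ 2 := by
  have hhi : IntegrableOn h (Ioo 0 T) := hh.integrable (by norm_num)
  have hI := integrableOn_inner_of_memLp hu hh
  have hu2 : IntegrableOn (fun τ => ‖u τ‖ ^ 2) (Ioo 0 T) := hu.integrable_norm_pow (by norm_num)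
  have hh2 : IntegrableOn (fun τ => ‖h τ‖ ^ 2) (Ioo 0 T) := hh.integrable_norm_pow (by norm_num)
  have zero_mem : (0 : ℝ) ∈ Icc 0 T := left_mem_Icc.2 hT.le
  have hsub : Ioc s t ⊆ Icc 0 T := fun x hx => ⟨hs.1.trans hx.1.le, hx.2.trans ht.2⟩
  obtain ⟨r, hr, hrc, hrm⟩ : ∃ r ∈ Icc s t, adjoint j (j (u r)) = c + ∫ s in (0 : ℝ)..r, h s ∧
      (t - s) * ‖u r‖ ^ 2 ≤ ∫ τ in s..t, ‖u τ‖ ^ 2 := by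
    have hsub' : Ioo s t ⊆ Ioo 0 T := Ioo_subset_Ioo hs.1 ht.2
    have hc' : ∀ᵐ r ∂volume.restrict (Ioo s t),
        r ∈ Ioo s t ∧ adjoint j (j (u r)) = c + ∫ s in (0 : ℝ)..r, h s :=
      (ae_restrict_mem measurableSet_Ioo).and
        (ae_mono (Measure.restrict_mono hsub' le_rfl) hc)
    have : IsFiniteMeasure (volume.restrict (Ioo s t)) := by infer_instance
    obtain ⟨r, hr1, hr2⟩ := exists_notMem_null_le_average (μ := volume.restrict (Ioo s t))
      (by rw [Ne, Measure.restrict_eq_zero, Real.volume_Ioo]; simp [hst])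
      (hu2.mono_set hsub') hc'
    rw [mem_compl_iff, not_not] at hr1
    refine ⟨r, Ioo_subset_Icc_self hr1.1, hr1.2, ?_⟩
    rw [setAverage_eq, measureReal_def, Real.volume_Ioo, ENNReal.toReal_ofReal (by linarith),
      smul_eq_mul, ← integral_Ioc_eq_integral_Ioo, ← intervalIntegral.integral_of_le hst.le,
      ← div_eq_inv_mul, le_div_iff₀ (by linarith)] at hr2
    linarith
  have hrT : r ∈ Icc 0 T := ⟨hs.1.trans hr.1, hr.2.trans ht.2⟩
  have hint : ∀ {f : ℝ → ℝ}, IntegrableOn f (Ioo 0 T) → ∀ {x y}, x ∈ Icc 0 T → y ∈ Icc 0 T →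
    IntervalIntegrable f volume x y := fun {f} hf {x y} hx hy =>
      intervalIntegrable_of_integrableOn_Ioo hf hx hy
  have key : ∀ x ∈ Icc s t, adjoint j (j (u x)) = c + ∫ s in (0 : ℝ)..x, h s →
      ‖j (u x) - j (u r)‖ ^ 2 ≤ ∫ τ in s..t, ‖h τ‖ ^ 2 + 4 * ‖u τ‖ ^ 2 := by
    intro x hx hxc
    have hxT : x ∈ Icc 0 T := ⟨hs.1.trans hx.1, hx.2.trans ht.2⟩
    have e1 := norm_sq_sub_norm_sq_eq_integral j hj hT hu hh c hc hrT hxT hrc hxc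
    rw [intervalIntegral.integral_interval_sub_left (hint hI zero_mem hxT)
      (hint hI zero_mem hrT)] at e1
    have hhx := intervalIntegrable_of_integrableOn_Ioo hhi hrT hxT
    have e2 : inner ℝ (j (u x)) (j (u r)) - inner ℝ (j (u r)) (j (u r))
        = ∫ τ in r..x, inner ℝ (h τ) (u r) := by
      rw [← inner_sub_left, ← map_sub, ← ContinuousLinearMap.adjoint_inner_left, map_sub, map_sub,
        hxc, hrc, add_sub_add_left_eq_sub, intervalIntegral.integral_interval_sub_left
        (intervalIntegrable_of_integrableOn_Ioo hhi zero_mem hxT)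
        (intervalIntegrable_of_integrableOn_Ioo hhi zero_mem hrT), real_inner_comm]
      have := (innerSL ℝ (u r)).intervalIntegral_comp_comm hhx
      simp only [innerSL_apply_apply] at this
      rw [← this]
      exact intervalIntegral.integral_congr fun τ _ => real_inner_comm _ _
    have ihr : IntervalIntegrable (fun τ => inner ℝ (h τ) (u r)) volume r x :=
      ⟨hhx.1.inner_const _, hhx.2.inner_const _⟩
    have e3 : ‖j (u x) - j (u r)‖ ^ 2 = ∫ τ in r..x, 2 * inner ℝ (h τ) (u τ - u r) := by
      have e4 : ∫ τ in r..x, 2 * inner ℝ (h τ) (u τ - u r)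
          = 2 * (∫ τ in r..x, inner ℝ (h τ) (u τ)) - 2 * ∫ τ in r..x, inner ℝ (h τ) (u r) := by
        rw [intervalIntegral.integral_const_mul, ← mul_sub,
          ← intervalIntegral.integral_sub (hint hI hrT hxT) ihr]
        exact congrArg _ (intervalIntegral.integral_congr fun τ _ => inner_sub_right _ _ _)
      rw [e4, ← e1, ← e2, norm_sub_sq_real, real_inner_self_eq_norm_sq]
      ring
    have ia : IntegrableOn (fun τ => ‖h τ‖ ^ 2 + 2 * ‖u τ‖ ^ 2) (Ioo 0 T) :=
      hh2.add (hu2.const_mul 2)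
    have ib : IntegrableOn (fun τ => ‖h τ‖ ^ 2 + 2 * ‖u τ‖ ^ 2 + 2 * ‖u r‖ ^ 2) (Ioo 0 T) :=
      ia.add (integrable_const _)
    calc ‖j (u x) - j (u r)‖ ^ 2 ≤ |∫ τ in r..x, 2 * inner ℝ (h τ) (u τ - u r)| := by
          rw [e3]; exact le_abs_self _
      _ ≤ |∫ τ in r..x, ‖h τ‖ ^ 2 + 2 * ‖u τ‖ ^ 2 + 2 * ‖u r‖ ^ 2| := by
          rw [← Real.norm_eq_abs]
          refine intervalIntegral.norm_integral_le_abs_of_norm_le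
            (Eventually.of_forall fun τ => ?_) (hint ib hrT hxT)
          have h1 := norm_inner_le_norm (𝕜 := ℝ) (h τ) (u τ - u r)
          have h2 := norm_sub_le (u τ) (u r)
          rw [norm_mul, Real.norm_ofNat]
          nlinarith [norm_nonneg (h τ), norm_nonneg (u τ - u r), sq_nonneg (‖u τ‖ - ‖u r‖),
            sq_nonneg (‖h τ‖ - ‖u τ - u r‖), norm_nonneg (u τ), norm_nonneg (u r),
            mul_self_le_mul_self (norm_nonneg _) h2]
      _ ≤ ∫ τ in s..t, ‖h τ‖ ^ 2 + 2 * ‖u τ‖ ^ 2 + 2 * ‖u r‖ ^ 2 := by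
          rw [intervalIntegral.integral_of_le hst.le, intervalIntegral.abs_integral_eq_abs_integral_uIoc,
            abs_of_nonneg (integral_nonneg fun τ => by positivity)]
          refine setIntegral_mono_set (intervalIntegrable_iff_integrableOn_Ioc_of_le hst.le |>.1
            (hint ib hs ht)) (Eventually.of_forall fun τ => by positivity)
            (LE.le.eventuallyLE ?_)
          intro y hy
          rw [mem_uIoc] at hy
          rcases hy with hy | hy
          · exact ⟨hr.1.trans_lt hy.1, hy.2.trans hx.2⟩
          · exact ⟨hx.1.trans_lt hy.1, hy.2.trans hr.2⟩
      _ = (∫ τ in s..t, ‖h τ‖ ^ 2 + 2 * ‖u τ‖ ^ 2) + 2 * ((t - s) * ‖u r‖ ^ 2) := by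
          rw [intervalIntegral.integral_add (hint ia hs ht) intervalIntegrable_const,
            intervalIntegral.integral_const, smul_eq_mul]
          ring
      _ ≤ (∫ τ in s..t, ‖h τ‖ ^ 2 + 2 * ‖u τ‖ ^ 2) + 2 * ∫ τ in s..t, ‖u τ‖ ^ 2 := by
          linarith
      _ = ∫ τ in s..t, ‖h τ‖ ^ 2 + 4 * ‖u τ‖ ^ 2 := by
          rw [← intervalIntegral.integral_const_mul, ← intervalIntegral.integral_add
            (hint ia hs ht) (hint (hu2.const_mul 2) hs ht)]
          exact intervalIntegral.integral_congr fun τ _ => by ring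
  have k1 := key t (right_mem_Icc.2 hst.le) hct
  have k2 := key s (left_mem_Icc.2 hst.le) hcs
  have k3 : ‖j (u t) - j (u s)‖ ≤ ‖j (u t) - j (u r)‖ + ‖j (u s) - j (u r)‖ := by
    rw [norm_sub_rev (j (u s))]; exact norm_sub_le_norm_sub_add_norm_sub _ _ _
  nlinarith [norm_nonneg (j (u t) - j (u s)), sq_nonneg (‖j (u t) - j (u r)‖ - ‖j (u s) - j (u r)‖),
    mul_self_le_mul_self (norm_nonneg _) k3]

/-- If `u ∈ L²(0,T;V)` and the weak time derivative `h` of `j† j u` lies in `L²(0,T;V)` (that is,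
`u_t ∈ L²(0,T;V')` when `V'` is identified with `V` by the Riesz isomorphism), then `u` has a
representative in `C([0,T];H)`, which satisfies the energy identity. -/
theorem exists_continuous_rep_of_weakDeriv (j : V →L[ℝ] H) (hj : Function.Injective j) {T : ℝ}
    (hT : 0 < T) {u h : ℝ → V} (hu : MemLp u 2 (volTime T)) (hh : MemLp h 2 (volTime T))
    (huh : IsWeakTimeDeriv T (fun t => adjoint j (j (u t))) h) :
    ∃ P : C(Icc (0 : ℝ) T, H),
      (∀ᵐ t ∂volTime T, ∀ ht : t ∈ Icc (0 : ℝ) T, P ⟨t, ht⟩ = j (u t)) ∧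
      (∀ t : Icc (0 : ℝ) T, adjoint j (P t)
        = adjoint j (P ⟨0, left_mem_Icc.2 hT.le⟩) + ∫ s in (0 : ℝ)..t, h s) ∧
      ∀ t : Icc (0 : ℝ) T, ‖P t‖ ^ 2
        = ‖P ⟨0, left_mem_Icc.2 hT.le⟩‖ ^ 2 + 2 * ∫ s in (0 : ℝ)..t, inner ℝ (h s) (u s) := by
  have hhi : IntegrableOn h (Ioo 0 T) := hh.integrable (by norm_num)
  have hui : IntegrableOn u (Ioo 0 T) := hu.integrable (by norm_num)
  have hI := integrableOn_inner_of_memLp hu hh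
  have zero_mem : (0 : ℝ) ∈ Icc 0 T := left_mem_Icc.2 hT.le
  have T_mem : T ∈ Icc 0 T := right_mem_Icc.2 hT.le
  obtain ⟨c, hc⟩ := huh.exists_eq_primitive hT
    (((adjoint j).comp j).integrable_comp hui) hhi
  have prim_cont : ∀ {E : Type} [NormedAddCommGroup E] [NormedSpace ℝ E] {f : ℝ → E} (c : E),
      IntegrableOn f (Ioo 0 T) →
      Continuous fun t : Icc (0 : ℝ) T => c + ∫ s in (0 : ℝ)..t, f s := by
    intro E _ _ f c hf
    have := continuousOn_const_add_primitive
      (intervalIntegrable_of_integrableOn_Ioo hf zero_mem T_mem) c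
    rw [uIcc_of_le hT.le] at this
    exact continuousOn_iff_continuous_domRestrict.1 this
  set S : Set (Icc (0 : ℝ) T) := {t | (t : ℝ) ∈ Ioo 0 T ∧
    adjoint j (j (u t)) = c + ∫ s in (0 : ℝ)..t, h s} with hS
  have Sd : Dense S := dense_setOf_mem_Icc_of_ae hT hc
  set f : S → H := fun t => j (u (t : Icc (0 : ℝ) T)) with hf
  have hκ : IntegrableOn (fun τ => ‖h τ‖ ^ 2 + 4 * ‖u τ‖ ^ 2) (Ioo 0 T) :=
    (hh.integrable_norm_pow (by norm_num)).add ((hu.integrable_norm_pow (by norm_num)).const_mul 4)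
  have fu : UniformContinuous f := by
    have Φu := CompactSpace.uniformContinuous_of_continuous (prim_cont 0 hκ)
    rw [Metric.uniformContinuous_iff] at Φu ⊢
    intro ε hε
    obtain ⟨δ, hδ, Hδ⟩ := Φu (ε ^ 2 / 4) (by positivity)
    refine ⟨δ, hδ, ?_⟩
    have main : ∀ a b : S, (a : ℝ) < b → dist a b < δ → dist (f a) (f b) < ε := by
      intro a b hab hd
      have h1 := Hδ (show dist (a : Icc (0 : ℝ) T) b < δ from hd)
      rw [dist_comm, Real.dist_eq, zero_add, zero_add, intervalIntegral.integral_interval_sub_left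
        (intervalIntegrable_of_integrableOn_Ioo hκ zero_mem b.1.2)
        (intervalIntegrable_of_integrableOn_Ioo hκ zero_mem a.1.2)] at h1
      have h2 := norm_sub_sq_le_of_weakDeriv j hj hT hu hh c hc a.1.2 b.1.2 hab a.2.2 b.2.2
      have h3 := (le_abs_self _).trans_lt h1
      rw [dist_comm, dist_eq_norm]
      refine lt_of_pow_lt_pow_left₀ 2 hε.le ?_
      simp only [hf]
      linarith
    intro a b hd
    rcases lt_trichotomy (a : ℝ) b with hab | hab | hab
    · exact main a b hab hd
    · have : a = b := Subtype.ext (Subtype.ext hab)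
      rw [this, dist_self]; exact hε
    · rw [dist_comm]; exact main b a hab (by rwa [dist_comm])
  set P : C(Icc (0 : ℝ) T, H) := ⟨Sd.extend f, (Sd.uniformContinuous_extend fu).continuous⟩ with hP
  have PS : ∀ t : Icc (0 : ℝ) T, t ∈ S → P t = j (u t) := fun t ht =>
    Sd.extend_eq fu.continuous ⟨t, ht⟩
  have hA : ∀ t : Icc (0 : ℝ) T, adjoint j (P t) = c + ∫ s in (0 : ℝ)..t, h s := by
    refine fun t => congr_fun (Continuous.ext_on Sd ((adjoint j).continuous.comp P.continuous)
      (prim_cont c hhi) fun t ht => ?_) t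
    rw [Function.comp_apply, PS t ht, ht.2]
  have hc0 : c = adjoint j (P ⟨0, zero_mem⟩) := by
    rw [hA]; simp
  refine ⟨P, ?_, fun t => by rw [hA, ← hc0], ?_⟩
  · filter_upwards [hc, ae_restrict_mem measurableSet_Ioo] with t h1 h2 ht
    exact PS ⟨t, ht⟩ ⟨h2, h1⟩
  · obtain ⟨t₀, ht₀⟩ : S.Nonempty := Sd.nonempty_iff.2 ⟨⟨0, zero_mem⟩⟩
    set K : ℝ := ‖P t₀‖ ^ 2 - 2 * ∫ s in (0 : ℝ)..t₀, inner ℝ (h s) (u s) with hK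
    have hE : ∀ t : Icc (0 : ℝ) T, ‖P t‖ ^ 2
        = K + 2 * (0 + ∫ s in (0 : ℝ)..t, inner ℝ (h s) (u s)) := by
      refine fun t => congr_fun (Continuous.ext_on Sd (P.continuous.norm.pow 2)
        (((prim_cont 0 hI).const_mul 2).const_add K) fun t ht => ?_) t
      have := norm_sq_sub_norm_sq_eq_integral j hj hT hu hh c hc t₀.2 t.2 ht₀.2 ht.2
      change ‖P t‖ ^ 2 = _
      simp only [hK, PS t ht, PS t₀ ht₀]
      linarith
    have hE0 := hE ⟨0, zero_mem⟩
    intro t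
    rw [hE0, hE t]
    simp

end

/-! ### The weighted Sobolev space -/

section

variable {a : ℝ → ℝ}

theorem IsLocAbsCont.continuousOn {w : ℝ → ℝ} (hw : IsLocAbsCont w) :
    ContinuousOn w (Ioo (-1) 1) := by
  intro x hx
  have h1 := (hw ((x - 1) / 2) ((x + 1) / 2) (by linarith [hx.1]) (by linarith)
    (by linarith [hx.2])).continuousOn
  rw [uIcc_of_le (by linarith)] at h1
  exact (h1.continuousAt (Icc_mem_nhds (by linarith [hx.1]) (by linarith [hx.2]))).continuousWithinAt

/-- On compact subintervals of `Ω` the coefficient is bounded away from zero, so that dividing a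
square integrable function by `√a` gives a locally integrable one. -/
theorem IsDegenerateCoefficient.exists_inv_sqrt_bound (ha : IsDegenerateCoefficient a) {c d : ℝ}
    (hc : -1 < c) (hd : d < 1) : ∃ C, 0 ≤ C ∧ ∀ x ∈ Icc c d, (√(a x))⁻¹ ≤ C := by
  have hsub : Icc c d ⊆ Icc (-1) 1 := Icc_subset_Icc hc.le hd.le
  have hcont : ContinuousOn (fun x => (√(a x))⁻¹) (Icc c d) :=
    ((ha.contDiffOn.continuousOn.mono hsub).sqrt).inv₀ fun x hx =>
      (Real.sqrt_pos.2 (ha.pos x ⟨hc.trans_le hx.1, hx.2.trans_lt hd⟩)).ne'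
  obtain ⟨C, hC⟩ := isCompact_Icc.exists_bound_of_continuousOn hcont
  exact ⟨max C 0, le_max_right _ _, fun x hx =>
    ((Real.le_norm_self _).trans (hC x hx)).trans (le_max_left _ _)⟩

theorem IsDegenerateCoefficient.aestronglyMeasurable_inv_sqrt (ha : IsDegenerateCoefficient a) :
    AEStronglyMeasurable (fun x => (√(a x))⁻¹) volΩ := by
  have : ContinuousOn (fun x => (√(a x))⁻¹) (Ioo (-1) 1) :=
    ((ha.contDiffOn.continuousOn.mono Ioo_subset_Icc_self).sqrt).inv₀ fun x hx =>
      (Real.sqrt_pos.2 (ha.pos x hx)).ne'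
  exact this.aestronglyMeasurable measurableSet_Ioo

theorem Icc_subset_Omega {c d : ℝ} (hc : -1 < c) (hd : d < 1) : Icc c d ⊆ Ioo (-1 : ℝ) 1 :=
  Icc_subset_Ioo hc hd

theorem IsDegenerateCoefficient.memLp_div_sqrt (ha : IsDegenerateCoefficient a) {c d : ℝ}
    (hc : -1 < c) (hd : d < 1) (g : L2Ω) :
    MemLp (fun x => g x * (√(a x))⁻¹) 2 (volume.restrict (Icc c d)) := by
  obtain ⟨C, hC0, hC⟩ := ha.exists_inv_sqrt_bound hc hd
  have hle : volume.restrict (Icc c d) ≤ volΩ :=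
    Measure.restrict_mono (Icc_subset_Omega hc hd) le_rfl
  have hg : MemLp g 2 (volume.restrict (Icc c d)) := (Lp.memLp g).mono_measure hle
  refine (hg.const_mul C).mono (hg.1.mul (ha.aestronglyMeasurable_inv_sqrt.mono_measure hle)) ?_
  filter_upwards [ae_restrict_mem measurableSet_Icc] with x hx
  rw [norm_mul, norm_mul, Real.norm_of_nonneg hC0, mul_comm C]
  refine mul_le_mul_of_nonneg_left ?_ (norm_nonneg _)
  rw [Real.norm_of_nonneg (by positivity)]
  exact hC x hx

theorem IsDegenerateCoefficient.intervalIntegrable_div_sqrt (ha : IsDegenerateCoefficient a)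
    {x y : ℝ} (hx : x ∈ Ioo (-1 : ℝ) 1) (hy : y ∈ Ioo (-1 : ℝ) 1) (g : L2Ω) :
    IntervalIntegrable (fun s => g s * (√(a s))⁻¹) volume x y := by
  rw [intervalIntegrable_iff]
  have h1 : -1 < min x y := lt_min hx.1 hy.1
  have h2 : max x y < 1 := max_lt hx.2 hy.2
  exact IntegrableOn.mono_set ((ha.memLp_div_sqrt h1 h2 g).integrable (by norm_num))
    uIoc_subset_uIcc

/-- The increments of a locally absolutely continuous function are recovered from its weighted
derivative. -/
theorem sub_eq_integral_div_sqrt (ha : IsDegenerateCoefficient a) {w : ℝ → ℝ}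
    (hw : IsLocAbsCont w) {g : L2Ω} (hg : (g : ℝ → ℝ) =ᵐ[volΩ] fun x => √(a x) * deriv w x)
    {x y : ℝ} (hx : x ∈ Ioo (-1 : ℝ) 1) (hy : y ∈ Ioo (-1 : ℝ) 1) :
    w y - w x = ∫ s in x..y, g s * (√(a s))⁻¹ := by
  wlog hxy : x ≤ y generalizing x y
  · rw [intervalIntegral.integral_symm, ← this hy hx (le_of_not_ge hxy)]; ring
  rw [← (hw x y hx.1 hxy hy.2).integral_deriv_eq_sub]
  refine intervalIntegral.integral_congr_ae ?_
  rw [EventuallyEq, ae_restrict_iff' measurableSet_Ioo] at hg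
  filter_upwards [hg] with s hs hsm
  rw [uIoc_of_le hxy] at hsm
  have hsΩ : s ∈ Ioo (-1 : ℝ) 1 := ⟨hx.1.trans hsm.1, hsm.2.trans_lt hy.2⟩
  rw [hs hsΩ, mul_comm, inv_mul_cancel_left₀ (Real.sqrt_pos.2 (ha.pos s hsΩ)).ne']

/-- Primitives of `g / √a` with `g ∈ L²(Ω)` are locally absolutely continuous, with weighted
derivative `g`. -/
theorem isLocAbsCont_primitive_div_sqrt (ha : IsDegenerateCoefficient a) (g : L2Ω) (C : ℝ)
    {x₀ : ℝ} (hx₀ : x₀ ∈ Ioo (-1 : ℝ) 1) :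
    IsLocAbsCont (fun x => C + ∫ s in x₀..x, g s * (√(a s))⁻¹) ∧
      (g : ℝ → ℝ) =ᵐ[volΩ] fun x =>
        √(a x) * deriv (fun x => C + ∫ s in x₀..x, g s * (√(a s))⁻¹) x := by
  constructor
  · intro c d hc hcd hd
    have hcc : min c x₀ ∈ Ioo (-1 : ℝ) 1 := ⟨lt_min hc hx₀.1, (min_le_right _ _).trans_lt hx₀.2⟩
    have hdd : max d x₀ ∈ Ioo (-1 : ℝ) 1 := ⟨hx₀.1.trans_le (le_max_right _ _), max_lt hd hx₀.2⟩
    have hle : min c x₀ ≤ max d x₀ := (min_le_right _ _).trans (le_max_right _ _)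
    have h1 := (ha.intervalIntegrable_div_sqrt hcc hdd
      g).absolutelyContinuousOnInterval_intervalIntegral (c := x₀) (by
        rw [uIcc_of_le hle]; exact ⟨min_le_right _ _, le_max_right _ _⟩)
    have h2 : AbsolutelyContinuousOnInterval (fun _ : ℝ => C) (min c x₀) (max d x₀) :=
      (LipschitzOnWith.of_dist_le_mul (K := 0) (by simp)).absolutelyContinuousOnInterval
    refine (h2.add h1).mono ?_
    rw [uIcc_of_le hle, uIcc_of_le hcd]
    exact Icc_subset_Icc (min_le_left _ _) (le_max_left _ _)
  · have key : ∀ n : ℕ, ∀ᵐ x : ℝ, x ∈ Ioo (-1 + 1 / ((n : ℝ) + 1)) (1 - 1 / ((n : ℝ) + 1)) →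
        x₀ ∈ Ioo (-1 + 1 / ((n : ℝ) + 1)) (1 - 1 / ((n : ℝ) + 1)) →
        HasDerivAt (fun x => ∫ s in x₀..x, g s * (√(a s))⁻¹) (g x * (√(a x))⁻¹) x := by
      intro n
      by_cases hx0n : x₀ ∈ Ioo (-1 + 1 / ((n : ℝ) + 1)) (1 - 1 / ((n : ℝ) + 1))
      · have hn : (0 : ℝ) < 1 / ((n : ℝ) + 1) := by positivity
        have hlt := hx0n.1.trans hx0n.2
        filter_upwards [(ha.intervalIntegrable_div_sqrt
          (x := -1 + 1 / ((n : ℝ) + 1)) (y := 1 - 1 / ((n : ℝ) + 1)) ⟨by linarith, by linarith⟩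
          ⟨by linarith, by linarith⟩ g).ae_hasDerivAt_integral] with x hx h1 h2
        rw [uIcc_of_le hlt.le] at hx
        exact hx (Ioo_subset_Icc_self h1) x₀ (Ioo_subset_Icc_self h2)
      · exact Eventually.of_forall fun x _ h => absurd h hx0n
    rw [EventuallyEq, ae_restrict_iff' measurableSet_Ioo]
    filter_upwards [ae_all_iff.2 key] with x hx hxm
    obtain ⟨n, hn⟩ := exists_nat_one_div_lt
      (show (0 : ℝ) < min (min (x + 1) (1 - x)) (min (x₀ + 1) (1 - x₀)) from
        lt_min (lt_min (by linarith [hxm.1]) (by linarith [hxm.2]))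
          (lt_min (by linarith [hx₀.1]) (by linarith [hx₀.2])))
    rw [lt_min_iff, lt_min_iff, lt_min_iff] at hn
    have h1 := hx n ⟨by linarith [hn.1.1], by linarith [hn.1.2]⟩
      ⟨by linarith [hn.2.1], by linarith [hn.2.2]⟩
    rw [(h1.const_add C).deriv, mul_comm, inv_mul_cancel_right₀ (Real.sqrt_pos.2 (ha.pos x hxm)).ne']

/-- `H¹_a(Ω)` is complete: the relation `u(y) - u(x) = ∫ₓʸ g / √a` between a function and its
weighted derivative passes to limits in `L²(Ω) × L²(Ω)`. -/
theorem isClosed_H1a (ha : IsDegenerateCoefficient a) :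
    IsClosed (H1a a : Set (WithLp 2 (L2Ω × L2Ω))) := by
  refine isSeqClosed_iff_isClosed.1 ?_
  intro U U₀ hU hlim
  choose w hw h1 h2 using hU
  have hfst : Tendsto (fun n => (U n).fst) atTop (𝓝 U₀.fst) :=
    ((WithLp.fstL 2 ℝ L2Ω L2Ω).continuous.tendsto U₀).comp hlim
  have hsnd : Tendsto (fun n => (U n).snd) atTop (𝓝 U₀.snd) :=
    ((WithLp.sndL 2 ℝ L2Ω L2Ω).continuous.tendsto U₀).comp hlim
  -- pass to a subsequence converging almost everywhere
  obtain ⟨φ, hφ, hae⟩ := (tendstoInMeasure_of_tendsto_Lp hfst).exists_seq_tendsto_ae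
  have hwae : ∀ᵐ x ∂volΩ, Tendsto (fun n => w (φ n) x) atTop (𝓝 (U₀.fst x)) := by
    filter_upwards [hae, ae_all_iff.2 h1] with x e1 e2
    exact e1.congr fun n => e2 _
  have hint : ∀ {x y : ℝ}, x ∈ Ioo (-1 : ℝ) 1 → y ∈ Ioo (-1 : ℝ) 1 →
      Tendsto (fun n => ∫ s in x..y, (U n).snd s * (√(a s))⁻¹) atTop
        (𝓝 (∫ s in x..y, U₀.snd s * (√(a s))⁻¹)) := by
    intro x y hx hy
    set c := min x y
    set d := max x y
    have hc : -1 < c := lt_min hx.1 hy.1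
    have hd : d < 1 := max_lt hx.2 hy.2
    -- the integral is the inner product with a fixed element of `L²(Ω)`
    obtain ⟨C, hC0, hC⟩ := ha.exists_inv_sqrt_bound hc hd
    have hm : MemLp ((uIoc x y).indicator fun s => (√(a s))⁻¹) 2 volΩ := by
      refine MemLp.of_bound (ha.aestronglyMeasurable_inv_sqrt.indicator measurableSet_uIoc) C
        (Eventually.of_forall fun s => ?_)
      by_cases hs : s ∈ uIoc x y
      · rw [indicator_of_mem hs, Real.norm_of_nonneg (by positivity)]
        exact hC s (uIoc_subset_uIcc hs)
      · rw [indicator_of_notMem hs, norm_zero]; exact hC0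
    have hin : ∀ g : L2Ω, ∫ s in uIoc x y, g s * (√(a s))⁻¹ = inner ℝ (hm.toLp _) g := by
      intro g
      rw [L2.inner_def]
      have hsub : uIoc x y ⊆ Ioo (-1 : ℝ) 1 :=
        uIoc_subset_uIcc.trans (Icc_subset_Omega hc hd)
      have e1 : ∫ s in uIoc x y, g s * (√(a s))⁻¹
          = ∫ s in uIoc x y, g s * (√(a s))⁻¹ ∂volΩ := by
        rw [Measure.restrict_restrict measurableSet_uIoc, inter_eq_left.2 hsub]
      rw [e1, ← integral_indicator measurableSet_uIoc]
      refine integral_congr_ae ?_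
      filter_upwards [hm.coeFn_toLp] with s hs
      rw [hs]
      by_cases hs' : s ∈ uIoc x y <;> simp [hs']
    simp only [intervalIntegral.intervalIntegral_eq_integral_uIoc, hin]
    exact (tendsto_const_nhds.inner hsnd).const_smul _
  have hne : (ae volΩ).NeBot := by
    rw [ae_neBot, Ne, Measure.restrict_eq_zero, Real.volume_Ioo]; norm_num
  obtain ⟨x₀, hx₀, hx₀Ω⟩ := (hwae.and (ae_restrict_mem measurableSet_Ioo)).exists
  obtain ⟨k1, k2⟩ := isLocAbsCont_primitive_div_sqrt ha U₀.snd (U₀.fst x₀) hx₀Ω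
  refine ⟨_, k1, ?_, k2⟩
  filter_upwards [hwae, ae_restrict_mem measurableSet_Ioo] with x hx hxΩ
  refine tendsto_nhds_unique hx ((hx₀.add ((hint hx₀Ω hxΩ).comp hφ.tendsto_atTop)).congr fun n => ?_)
  rw [Function.comp_apply, ← sub_eq_integral_div_sqrt ha (hw _) (h2 _) hx₀Ω hxΩ]
  ring

theorem completeSpace_H1a (ha : IsDegenerateCoefficient a) : CompleteSpace (H1a a) :=
  (isClosed_H1a ha).completeSpace_coe

theorem H1a.norm_sq_eq (U : H1a a) : ‖U‖ ^ 2 = ‖H1a.toL2 U‖ ^ 2 + ‖H1a.weightedDeriv U‖ ^ 2 :=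
  WithLp.prod_norm_sq_eq_of_L2 _

theorem H1a.toL2_injective : Function.Injective (H1a.toL2 (a := a)) := by
  rw [injective_iff_map_eq_zero]
  rintro ⟨U, w, hw, h1, h2⟩ h0
  have hU : U.fst = 0 := h0
  have hw0 : EqOn w 0 (Ioo (-1) 1) := by
    refine Measure.eqOn_open_of_ae_eq (μ := volume) ?_ isOpen_Ioo hw.continuousOn continuousOn_const
    filter_upwards [h1, Lp.coeFn_zero ℝ 2 volΩ] with x e1 e2
    rw [← e1, hU, e2]
  have hsnd : U.snd = 0 := by
    refine Lp.ext ?_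
    filter_upwards [h2, Lp.coeFn_zero ℝ 2 volΩ, ae_restrict_mem measurableSet_Ioo] with x e1 e2 e3
    have : w =ᶠ[𝓝 x] fun _ => 0 := hw0.eventuallyEq_of_mem (isOpen_Ioo.mem_nhds e3)
    rw [e1, e2, this.deriv_eq, deriv_const, mul_zero, Pi.zero_apply]
  ext1
  exact (WithLp.equiv 2 _).injective (Prod.ext hU hsnd)

/-- Smooth functions with compact support in `Ω` belong to `H¹_a(Ω)`, so that `H¹_a(Ω)` is dense
in `L²(Ω)`. -/
theorem eq_zero_of_inner_toL2_eq_zero (ha : IsDegenerateCoefficient a) (y : L2Ω)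
    (hy : ∀ U : H1a a, inner ℝ y (H1a.toL2 U) = 0) : y = 0 := by
  have hyi : IntegrableOn y (Ioo (-1 : ℝ) 1) := (Lp.memLp y).integrable (by norm_num)
  have main := isOpen_Ioo.ae_eq_zero_of_integral_contDiff_smul_eq_zero (μ := volume)
    hyi.locallyIntegrableOn fun η η1 η2 η3 => by
    have ηc := η1.continuous
    have ηd : Continuous (deriv η) := η1.continuous_deriv (by exact_mod_cast le_top)
    have m1 : MemLp η 2 volΩ := (ηc.memLp_of_hasCompactSupport η2).restrict _
    have m2 : MemLp (fun x => √(a x) * deriv η x) 2 volΩ := by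
      obtain ⟨C, hC⟩ := isCompact_Icc.exists_bound_of_continuousOn
        ((ha.contDiffOn.continuousOn.sqrt).mul ηd.continuousOn)
      refine MemLp.of_bound (((ha.contDiffOn.continuousOn.sqrt).mul ηd.continuousOn).mono
        Ioo_subset_Icc_self |>.aestronglyMeasurable measurableSet_Ioo) C ?_
      filter_upwards [ae_restrict_mem measurableSet_Ioo] with x hx
      exact hC x (Ioo_subset_Icc_self hx)
    have hη := hy ⟨WithLp.toLp 2 (m1.toLp η, m2.toLp _), η, fun c d _ _ _ =>
      (η1.contDiffOn.of_le (by exact_mod_cast le_top)).absolutelyContinuousOnInterval,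
      m1.coeFn_toLp, m2.coeFn_toLp⟩
    change inner ℝ y (m1.toLp η) = 0 at hη
    rw [L2.inner_def] at hη
    rw [← hη, ← setIntegral_eq_integral_of_forall_compl_eq_zero (s := Ioo (-1 : ℝ) 1) fun x hx => by
      rw [image_eq_zero_of_notMem_tsupport fun h => hx (η3 h), zero_smul]]
    refine integral_congr_ae ?_
    filter_upwards [m1.coeFn_toLp] with x hx
    rw [hx]; simp
  refine Lp.ext ?_
  rw [EventuallyEq, ae_restrict_iff' measurableSet_Ioo]
  have h0 := Lp.coeFn_zero ℝ 2 volΩ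
  rw [EventuallyEq, ae_restrict_iff' measurableSet_Ioo] at h0
  filter_upwards [main, h0] with x e1 e2 hx
  rw [e1 hx, e2 hx, Pi.zero_apply]

end

/-! ### The zero-order term with bounded coefficient -/

section

theorem memLp_bounded_mul {q : ℝ → ℝ} (hq : StronglyMeasurable q) {C : ℝ} (hC : ∀ x, ‖q x‖ ≤ C)
    (y : L2Ω) : MemLp (fun x => q x * y x) 2 volΩ :=
  (Lp.memLp y).of_le_mul (c := C) (hq.aestronglyMeasurable.mul (Lp.memLp y).1)
    (Eventually.of_forall fun x => by
      rw [norm_mul]; exact mul_le_mul_of_nonneg_right (hC x) (norm_nonneg _))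

/-- Multiplication by a measurable function bounded by `C`, as a bounded operator on `L²(Ω)`. -/
def mulBounded (q : ℝ → ℝ) (hq : StronglyMeasurable q) (C : ℝ) (hC : ∀ x, ‖q x‖ ≤ C) :
    L2Ω →L[ℝ] L2Ω :=
  have hm := memLp_bounded_mul hq hC
  LinearMap.mkContinuous
    { toFun := fun y => (hm y).toLp _
      map_add' := fun y z => by
        refine Lp.ext ?_
        filter_upwards [(hm (y + z)).coeFn_toLp, (hm y).coeFn_toLp, (hm z).coeFn_toLp,
          Lp.coeFn_add y z, Lp.coeFn_add ((hm y).toLp _) ((hm z).toLp _)] with x e1 e2 e3 e4 e5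
        rw [e1, e5, Pi.add_apply, e2, e3, e4, Pi.add_apply, mul_add]
      map_smul' := fun r y => by
        refine Lp.ext ?_
        filter_upwards [(hm (r • y)).coeFn_toLp, (hm y).coeFn_toLp, Lp.coeFn_smul r y,
          Lp.coeFn_smul r ((hm y).toLp _)] with x e1 e2 e3 e4
        rw [e1, RingHom.id_apply, e4, Pi.smul_apply, e2, e3, Pi.smul_apply, smul_eq_mul,
          smul_eq_mul, mul_left_comm] }
    C fun y => by
      refine Lp.norm_le_mul_norm_of_ae_le_mul ?_
      filter_upwards [(hm y).coeFn_toLp] with x e1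
      change ‖((hm y).toLp _ : L2Ω) x‖ ≤ _
      rw [e1, norm_mul]
      exact mul_le_mul_of_nonneg_right (hC x) (norm_nonneg _)

theorem coeFn_mulBounded (q : ℝ → ℝ) (hq : StronglyMeasurable q) (C : ℝ) (hC : ∀ x, ‖q x‖ ≤ C)
    (y : L2Ω) : (mulBounded q hq C hC y : ℝ → ℝ) =ᵐ[volΩ] fun x => q x * y x :=
  (memLp_bounded_mul hq hC y).coeFn_toLp

theorem inner_mulBounded (q : ℝ → ℝ) (hq : StronglyMeasurable q) (C : ℝ) (hC : ∀ x, ‖q x‖ ≤ C)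
    (y z : L2Ω) : inner ℝ (mulBounded q hq C hC y) z = ∫ x, q x * y x * z x ∂volΩ := by
  rw [L2.inner_def]
  refine integral_congr_ae ?_
  filter_upwards [coeFn_mulBounded q hq C hC y] with x e1
  rw [e1, real_inner_eq_re_inner, RCLike.inner_apply]
  simp [mul_comm]

theorem norm_mulBounded_le (q : ℝ → ℝ) (hq : StronglyMeasurable q) (C : ℝ) (hC : ∀ x, ‖q x‖ ≤ C)
    (hC0 : 0 ≤ C) : ‖mulBounded q hq C hC‖ ≤ C :=
  ContinuousLinearMap.opNorm_le_bound _ hC0 fun y => by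
    refine Lp.norm_le_mul_norm_of_ae_le_mul ?_
    filter_upwards [coeFn_mulBounded q hq C hC y] with x e1
    rw [e1, norm_mul]
    exact mul_le_mul_of_nonneg_right (hC x) (norm_nonneg _)

/-- A family of bounded operators, measurable in the weak operator sense, is weakly measurable
along measurable functions. -/
theorem stronglyMeasurable_inner_apply (m : ℝ → L2Ω →L[ℝ] L2Ω)
    (hm : ∀ y z : L2Ω, StronglyMeasurable fun t => inner ℝ (m t y) z) {y z : ℝ → L2Ω}
    (hy : StronglyMeasurable y) (hz : StronglyMeasurable z) :
    StronglyMeasurable fun t => inner ℝ (m t (y t)) (z t) := by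
  have : Fact ((2 : ℝ≥0∞) ≠ ∞) := ⟨by norm_num⟩
  borelize (L2Ω × L2Ω)
  have h1 := stronglyMeasurable_uncurry_of_continuous_of_stronglyMeasurable
    (u := fun (p : L2Ω × L2Ω) (t : ℝ) => inner ℝ (m t p.1) p.2)
    (fun t => ((m t).continuous.comp continuous_fst).inner continuous_snd) (fun p => hm p.1 p.2)
  exact h1.comp_measurable ((hy.prodMk hz).measurable.prodMk measurable_id)

/-- A bounded family of operators which is measurable in the weak operator sense defines a bounded
operator on `L²(0,T;L²(Ω))`. -/
theorem exists_operator_of_family {T : ℝ} (m : ℝ → L2Ω →L[ℝ] L2Ω)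
    (hm : ∀ y z : L2Ω, StronglyMeasurable fun t => inner ℝ (m t y) z) {C : ℝ}
    (hC : ∀ t, ‖m t‖ ≤ C) :
    ∃ M : L2Time T L2Ω →L[ℝ] L2Time T L2Ω,
      (∀ y z, inner ℝ (M y) z = ∫ t in Ioo 0 T, inner ℝ (m t (y t)) (z t)) ∧
      ∀ y, ∀ t ∈ Icc 0 T, ∫ s in (0 : ℝ)..t, inner ℝ (M y s) (y s)
        ≤ C * ∫ s in (0 : ℝ)..t, ‖y s‖ ^ 2 := by
  have hC0 : 0 ≤ C := (norm_nonneg _).trans (hC 0)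
  have hbd : ∀ t (y z : L2Ω), ‖inner ℝ (m t y) z‖ ≤ C * (‖y‖ * ‖z‖) := fun t y z =>
    (norm_inner_le_norm _ _).trans (by
      rw [← mul_assoc]
      exact mul_le_mul_of_nonneg_right (((m t).le_opNorm y).trans
        (mul_le_mul_of_nonneg_right (hC t) (norm_nonneg _))) (norm_nonneg _))
  -- the pointwise norm of an element of `L²(0,T;L²(Ω))`
  set N : L2Time T L2Ω → L2Time T ℝ := fun y => (Lp.memLp y).norm.toLp _ with hN
  have hNn : ∀ y, ‖N y‖ = ‖y‖ := fun y => by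
    rw [hN, Lp.norm_toLp, eLpNorm_norm, Lp.norm_def]
  have hNae : ∀ y, ∀ᵐ t ∂volTime T, N y t = ‖y t‖ := fun y => (Lp.memLp y).norm.coeFn_toLp
  have hNi : ∀ y z : L2Time T L2Ω, Integrable (fun t => ‖y t‖ * ‖z t‖) (volTime T) ∧
      ∫ t in Ioo 0 T, ‖y t‖ * ‖z t‖ ≤ ‖y‖ * ‖z‖ := fun y z => by
    have e : (fun t => inner ℝ (N y t) (N z t)) =ᵐ[volTime T] fun t => ‖y t‖ * ‖z t‖ := by
      filter_upwards [hNae y, hNae z] with t e1 e2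
      rw [e1, e2, real_inner_eq_re_inner, RCLike.inner_apply]
      simp [mul_comm]
    refine ⟨(L2.integrable_inner (𝕜 := ℝ) (N y) (N z)).congr e, ?_⟩
    rw [← integral_congr_ae e, ← L2.inner_def, ← hNn y, ← hNn z]
    exact real_inner_le_norm _ _
  have hint : ∀ y z : L2Time T L2Ω,
      Integrable (fun t => inner ℝ (m t (y t)) (z t)) (volTime T) := fun y z =>
    ((hNi y z).1.const_mul C).mono' (stronglyMeasurable_inner_apply m hm (Lp.stronglyMeasurable y)
      (Lp.stronglyMeasurable z)).aestronglyMeasurable (Eventually.of_forall fun t => hbd t _ _)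
  set β : L2Time T L2Ω →ₗ[ℝ] L2Time T L2Ω →ₗ[ℝ] ℝ := LinearMap.mk₂ ℝ
    (fun y z => ∫ t in Ioo 0 T, inner ℝ (m t (y t)) (z t))
    (fun y y' z => by
      rw [← integral_add (hint y z) (hint y' z)]
      refine integral_congr_ae ?_
      filter_upwards [Lp.coeFn_add y y'] with t e
      rw [e, Pi.add_apply, map_add, inner_add_left])
    (fun r y z => by
      rw [smul_eq_mul, ← integral_const_mul]
      refine integral_congr_ae ?_
      filter_upwards [Lp.coeFn_smul r y] with t e
      rw [e, Pi.smul_apply, map_smul, real_inner_smul_left])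
    (fun y z z' => by
      rw [← integral_add (hint y z) (hint y z')]
      refine integral_congr_ae ?_
      filter_upwards [Lp.coeFn_add z z'] with t e
      rw [e, Pi.add_apply, inner_add_right])
    (fun r y z => by
      rw [smul_eq_mul, ← integral_const_mul]
      refine integral_congr_ae ?_
      filter_upwards [Lp.coeFn_smul r z] with t e
      rw [e, Pi.smul_apply, real_inner_smul_right]) with hβ
  have hβn : ∀ y z, ‖β y z‖ ≤ C * ‖y‖ * ‖z‖ := fun y z => by
    calc ‖β y z‖ ≤ ∫ t in Ioo 0 T, C * (‖y t‖ * ‖z t‖) :=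
          norm_integral_le_of_norm_le ((hNi y z).1.const_mul C)
            (Eventually.of_forall fun t => hbd t _ _)
      _ = C * ∫ t in Ioo 0 T, ‖y t‖ * ‖z t‖ := integral_const_mul _ _
      _ ≤ C * (‖y‖ * ‖z‖) := mul_le_mul_of_nonneg_left (hNi y z).2 hC0
      _ = C * ‖y‖ * ‖z‖ := by ring
  set M := InnerProductSpace.continuousLinearMapOfBilin (𝕜 := ℝ) (β.mkContinuous₂ C hβn) with hM
  have hMin : ∀ y z, inner ℝ (M y) z = ∫ t in Ioo 0 T, inner ℝ (m t (y t)) (z t) := fun y z => by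
    rw [hM, InnerProductSpace.continuousLinearMapOfBilin_apply, LinearMap.mkContinuous₂_apply]
    rfl
  refine ⟨M, hMin, fun y t ht => ?_⟩
  -- localise to `(0, t)` by testing with the truncation of `y`
  set z : L2Time T L2Ω := ((Lp.memLp y).indicator (s := Ioc 0 t) measurableSet_Ioc).toLp _ with hz
  have hzae : ∀ᵐ s ∂volTime T, z s = (Ioc 0 t).indicator y s := MemLp.coeFn_toLp _
  have hloc : ∀ f : ℝ → ℝ, ∫ s in (0 : ℝ)..t, f s
      = ∫ s in Ioo 0 T, (Ioc 0 t).indicator f s := fun f => by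
    rw [intervalIntegral.integral_of_le ht.1, ← integral_Ioc_eq_integral_Ioo,
      setIntegral_indicator measurableSet_Ioc, inter_eq_right.2 (Ioc_subset_Ioc_right ht.2)]
  have hi2 : Integrable (fun s => ‖y s‖ ^ 2) (volTime T) :=
    (Lp.memLp y).integrable_norm_pow (by norm_num)
  calc ∫ s in (0 : ℝ)..t, inner ℝ (M y s) (y s) = inner ℝ (M y) z := by
        rw [hloc, L2.inner_def]
        refine integral_congr_ae ?_
        filter_upwards [hzae] with s hs
        rw [hs]
        by_cases h : s ∈ Ioc 0 t <;> simp [h]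
    _ = ∫ s in Ioo 0 T, inner ℝ (m s (y s)) (z s) := hMin y z
    _ ≤ ∫ s in Ioo 0 T, (Ioc 0 t).indicator (fun s => C * ‖y s‖ ^ 2) s := by
        refine integral_mono_ae (hint y z) ((hi2.const_mul C).indicator measurableSet_Ioc) ?_
        filter_upwards [hzae] with s hs
        rw [hs]
        by_cases h : s ∈ Ioc 0 t
        · rw [indicator_of_mem h, indicator_of_mem h, sq]
          exact (Real.le_norm_self _).trans (hbd s _ _)
        · simp [h]
    _ = C * ∫ s in (0 : ℝ)..t, ‖y s‖ ^ 2 := by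
        rw [← hloc, intervalIntegral.integral_const_mul]

/-- The term `v χ_ω y` as a bounded operator on `L²(0,T;L²(Ω))`. The first property is stated for
arbitrary functions `y`, `z` in the classes `y'`, `z'`, and holds with the iterated integral over
`(0,T)` and `ω`. -/
theorem exists_potential_operator {T : ℝ} {ω : Set ℝ} (hω : MeasurableSet ω)
    (hω_sub : ω ⊆ Ioo (-1) 1) (v : LInfControl T ω) :
    ∃ M : L2Time T L2Ω →L[ℝ] L2Time T L2Ω,
      (∀ y z : ℝ → L2Ω, ∀ y' z' : L2Time T L2Ω, y =ᵐ[volTime T] y' → z =ᵐ[volTime T] z' →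
        ∫ t in Ioo 0 T, ∫ x in ω, v (t, x) * y t x * z t x = inner ℝ (M y') z') ∧
      ∀ y, ∀ t ∈ Icc 0 T, ∫ s in (0 : ℝ)..t, inner ℝ (M y s) (y s)
        ≤ ‖v‖ * ∫ s in (0 : ℝ)..t, ‖y s‖ ^ 2 := by
  have hv := Lp.stronglyMeasurable v
  -- the coefficient, cut off outside `ω` and where the essential bound fails
  set A : Set (ℝ × ℝ) := {p | p.2 ∈ ω ∧ ‖v p‖ ≤ ‖v‖} with hA
  have hAm : MeasurableSet A :=
    (measurable_snd hω).inter (measurableSet_le hv.norm.measurable measurable_const)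
  set w : ℝ × ℝ → ℝ := A.indicator v with hw
  have hwm : StronglyMeasurable w := hv.indicator hAm
  have hwb : ∀ p, ‖w p‖ ≤ ‖v‖ := fun p => by
    by_cases hp : p ∈ A
    · rw [hw, indicator_of_mem hp]; exact hp.2
    · rw [hw, indicator_of_notMem hp, norm_zero]; exact norm_nonneg _
  have hwt : ∀ t, StronglyMeasurable fun x => w (t, x) := fun t =>
    hwm.comp_measurable measurable_prodMk_left
  obtain ⟨M, hM1, hM2⟩ := exists_operator_of_family (T := T)
    (fun t => mulBounded (fun x => w (t, x)) (hwt t) ‖v‖ fun x => hwb _) (fun y z => by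
      simp only [inner_mulBounded]
      exact StronglyMeasurable.integral_prod_right (ν := volΩ)
        ((hwm.mul ((Lp.stronglyMeasurable y).comp_measurable measurable_snd)).mul
        ((Lp.stronglyMeasurable z).comp_measurable measurable_snd)))
    (fun t => norm_mulBounded_le _ _ _ _ (norm_nonneg _))
  refine ⟨M, fun y z y' z' hy hz => ?_, hM2⟩
  rw [hM1]
  have hae : ∀ᵐ p ∂(volTime T).prod (volume.restrict ω), ‖v p‖ ≤ ‖v‖ := by
    rw [Measure.prod_restrict, ← Measure.volume_eq_prod]
    have := ae_le_eLpNormEssSup (f := v) (μ := volume.restrict (Ioo 0 T ×ˢ ω))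
    filter_upwards [this] with p hp
    rw [Lp.norm_def, eLpNorm_exponent_top, ← toReal_enorm]
    refine ENNReal.toReal_mono ?_ hp
    have := (Lp.memLp v).2.ne
    rwa [eLpNorm_exponent_top] at this
  refine integral_congr_ae ?_
  filter_upwards [Measure.ae_ae_of_ae_prod hae, hy, hz] with t ht e1 e2
  rw [inner_mulBounded, e1, e2]
  have : ∫ x in ω, v (t, x) * y' t x * z' t x = ∫ x in ω, w (t, x) * y' t x * z' t x := by
    refine integral_congr_ae ?_
    filter_upwards [ht, ae_restrict_mem hω] with x h1 h2
    rw [hw, indicator_of_mem (show (t, x) ∈ A from ⟨h2, h1⟩)]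
  rw [this, ← inter_eq_right.2 hω_sub, ← setIntegral_indicator hω]
  refine integral_congr_ae (Eventually.of_forall fun x => ?_)
  by_cases hx : x ∈ ω
  · simp only [indicator_of_mem hx]
  · have : w (t, x) = 0 := indicator_of_notMem (fun h => hx h.1) _
    simp [hx, this]

end

/-! ### Test functions and exponential weights in time -/

section

section ExpWeight

variable {E : Type} [NormedAddCommGroup E] [NormedSpace ℝ E] {T : ℝ}

theorem memLp_smul_of_continuous {θ : ℝ → ℝ} (hθ : Continuous θ) {u : ℝ → E}
    (hu : MemLp u 2 (volTime T)) : MemLp (fun t => θ t • u t) 2 (volTime T) := by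
  obtain ⟨C, hC⟩ := (isCompact_Icc (a := (0 : ℝ)) (b := T)).exists_bound_of_continuousOn
    hθ.continuousOn
  refine hu.of_le_mul (c := C) (hθ.aestronglyMeasurable.smul hu.1) ?_
  filter_upwards [ae_restrict_mem measurableSet_Ioo] with t ht
  rw [norm_smul]
  exact mul_le_mul_of_nonneg_right (hC t (Ioo_subset_Icc_self ht)) (norm_nonneg _)

theorem integrableOn_smul_of_continuous {θ : ℝ → ℝ} (hθ : Continuous θ) {u : ℝ → E}
    (hu : IntegrableOn u (Ioo 0 T)) : IntegrableOn (fun t => θ t • u t) (Ioo 0 T) := by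
  have hu' : IntegrableOn u (Icc 0 T) := by rwa [integrableOn_Icc_iff_integrableOn_Ioo]
  exact (hu'.continuousOn_smul hθ.continuousOn isCompact_Icc).mono_set Ioo_subset_Icc_self

theorem continuous_exp_mul (μ : ℝ) : Continuous fun t : ℝ => Real.exp (μ * t) := by fun_prop

/-- The function `t ↦ e^{μt} u(t)` for `u ∈ L²(0,T;E)`. -/
def expWeight (μ : ℝ) (u : L2Time T E) : L2Time T E :=
  (memLp_smul_of_continuous (continuous_exp_mul μ) (Lp.memLp u)).toLp _

theorem coeFn_expWeight (μ : ℝ) (u : L2Time T E) :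
    (expWeight μ u : ℝ → E) =ᵐ[volTime T] fun t => Real.exp (μ * t) • u t :=
  MemLp.coeFn_toLp _

theorem norm_expWeight_le {μ C : ℝ} (hC : ∀ t ∈ Ioo 0 T, Real.exp (μ * t) ≤ C) (u : L2Time T E) :
    ‖expWeight μ u‖ ≤ C * ‖u‖ := by
  refine Lp.norm_le_mul_norm_of_ae_le_mul ?_
  filter_upwards [coeFn_expWeight μ u, ae_restrict_mem measurableSet_Ioo] with t e1 ht
  rw [e1, norm_smul, Real.norm_of_nonneg (Real.exp_pos _).le]
  exact mul_le_mul_of_nonneg_right (hC t ht) (norm_nonneg _)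

theorem expWeight_expWeight (μ ν : ℝ) (u : L2Time T E) :
    expWeight μ (expWeight ν u) = expWeight (μ + ν) u := by
  refine Lp.ext ?_
  filter_upwards [coeFn_expWeight μ (expWeight ν u), coeFn_expWeight ν u,
    coeFn_expWeight (μ + ν) u] with t e1 e2 e3
  rw [e1, e2, e3, smul_smul, ← Real.exp_add, add_mul]

theorem expWeight_zero (u : L2Time T E) : expWeight 0 u = u := by
  refine Lp.ext ?_
  filter_upwards [coeFn_expWeight 0 u] with t e1
  rw [e1, zero_mul, Real.exp_zero, one_smul]

theorem IsWeakTimeDeriv.congr {u u' g g' : ℝ → E} (h : IsWeakTimeDeriv T u g)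
    (hu : u =ᵐ[volTime T] u') (hg : g =ᵐ[volTime T] g') : IsWeakTimeDeriv T u' g' := by
  intro θ h1 h2 h3
  have e1 : ∫ t in Ioo 0 T, deriv θ t • u' t = ∫ t in Ioo 0 T, deriv θ t • u t :=
    integral_congr_ae (hu.mono fun t ht => by simp only [ht])
  have e2 : ∫ t in Ioo 0 T, θ t • g' t = ∫ t in Ioo 0 T, θ t • g t :=
    integral_congr_ae (hg.mono fun t ht => by simp only [ht])
  rw [e1, e2, h θ h1 h2 h3]

theorem IsWeakTimeDeriv.add {u u' g g' : ℝ → E} (h : IsWeakTimeDeriv T u g)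
    (h' : IsWeakTimeDeriv T u' g') (hu : IntegrableOn u (Ioo 0 T))
    (hu' : IntegrableOn u' (Ioo 0 T)) (hg : IntegrableOn g (Ioo 0 T))
    (hg' : IntegrableOn g' (Ioo 0 T)) : IsWeakTimeDeriv T (u + u') (g + g') := by
  intro θ h1 h2 h3
  have hd : Continuous (deriv θ) := h1.continuous_deriv (by exact_mod_cast le_top)
  simp only [Pi.add_apply, smul_add]
  rw [integral_add (integrableOn_smul_of_continuous hd hu) (integrableOn_smul_of_continuous hd hu'),
    integral_add (integrableOn_smul_of_continuous h1.continuous hg)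
    (integrableOn_smul_of_continuous h1.continuous hg'), h θ h1 h2 h3, h' θ h1 h2 h3, neg_add]

theorem IsWeakTimeDeriv.const_smul {u g : ℝ → E} (h : IsWeakTimeDeriv T u g) (r : ℝ) :
    IsWeakTimeDeriv T (r • u) (r • g) := by
  intro θ h1 h2 h3
  simp only [Pi.smul_apply, smul_comm _ r]
  rw [integral_smul, integral_smul, h θ h1 h2 h3, smul_neg]

theorem IsWeakTimeDeriv.clm_comp {F : Type} [NormedAddCommGroup F] [NormedSpace ℝ F]
    [CompleteSpace E] [CompleteSpace F] {u g : ℝ → E} (h : IsWeakTimeDeriv T u g)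
    (hu : IntegrableOn u (Ioo 0 T)) (hg : IntegrableOn g (Ioo 0 T)) (L : E →L[ℝ] F) :
    IsWeakTimeDeriv T (fun t => L (u t)) (fun t => L (g t)) := by
  intro θ h1 h2 h3
  have hd : Continuous (deriv θ) := h1.continuous_deriv (by exact_mod_cast le_top)
  simp only [← map_smul]
  rw [L.integral_comp_comm (integrableOn_smul_of_continuous hd hu),
    L.integral_comp_comm (integrableOn_smul_of_continuous h1.continuous hg), h θ h1 h2 h3, map_neg]

theorem IsWeakTimeDeriv.exp_smul {u g : ℝ → E} (h : IsWeakTimeDeriv T u g)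
    (hu : IntegrableOn u (Ioo 0 T)) (hg : IntegrableOn g (Ioo 0 T)) (μ : ℝ) :
    IsWeakTimeDeriv T (fun t => Real.exp (μ * t) • u t)
      (fun t => Real.exp (μ * t) • g t + μ • Real.exp (μ * t) • u t) := by
  intro θ h1 h2 h3
  have hd : Continuous (deriv θ) := h1.continuous_deriv (by exact_mod_cast le_top)
  have hexp : ContDiff ℝ ((⊤ : ℕ∞) : WithTop ℕ∞) fun t : ℝ => Real.exp (μ * t) := by fun_prop
  have hder : ∀ t, deriv (fun t => θ t * Real.exp (μ * t)) t
      = deriv θ t * Real.exp (μ * t) + θ t * (μ * Real.exp (μ * t)) := by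
    intro t
    have d1 : HasDerivAt θ (deriv θ t) t :=
      (h1.differentiable (by simp) t).hasDerivAt
    have d2 : HasDerivAt (fun t : ℝ => Real.exp (μ * t)) (μ * Real.exp (μ * t)) t := by
      simpa [mul_comm] using ((hasDerivAt_id t).const_mul μ).exp
    exact (d1.mul d2).deriv
  have key := h (fun t => θ t * Real.exp (μ * t)) (h1.mul hexp) h2.mul_right
    ((tsupport_mul_subset_left).trans h3)
  simp only [hder, add_smul, mul_smul] at key
  have hue := integrableOn_smul_of_continuous (continuous_exp_mul μ) hu
  have hge := integrableOn_smul_of_continuous (continuous_exp_mul μ) hg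
  have i1 : IntegrableOn (fun t => μ • Real.exp (μ * t) • u t) (Ioo 0 T) := hue.smul μ
  rw [integral_add (integrableOn_smul_of_continuous hd hue)
    (integrableOn_smul_of_continuous h1.continuous i1)] at key
  simp only [smul_add]
  rw [integral_add (integrableOn_smul_of_continuous h1.continuous hge)
    (integrableOn_smul_of_continuous h1.continuous i1), eq_sub_of_add_eq key]
  abel

end ExpWeight

section TestTriple

variable {V H : Type} [NormedAddCommGroup V] [InnerProductSpace ℝ V] [NormedAddCommGroup H]
  [InnerProductSpace ℝ H] {T : ℝ} {j : V →L[ℝ] H}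

theorem integrableOn_coeFn {E : Type} [NormedAddCommGroup E] (u : L2Time T E) :
    IntegrableOn u (Ioo 0 T) := (Lp.memLp u).integrable (by norm_num)

/-- The data of a test function: `φ ∈ L²(0,T;V)` with time derivative `g ∈ L²(0,T;H)`, final value
`0` and initial value `y`. -/
def IsTestTriple (j : V →L[ℝ] H) (hT : 0 < T) (x : L2Time T V × L2Time T H × H) : Prop :=
  IsWeakTimeDeriv T (fun t => j (x.1 t)) (fun t => x.2.1 t) ∧ ∃ P : C(Icc (0 : ℝ) T, H),
    (∀ᵐ t ∂volTime T, ∀ ht : t ∈ Icc (0 : ℝ) T, P ⟨t, ht⟩ = j (x.1 t)) ∧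
    P ⟨T, right_mem_Icc.2 hT.le⟩ = 0 ∧ P ⟨0, left_mem_Icc.2 hT.le⟩ = x.2.2

theorem IsTestTriple.add {hT : 0 < T} {x y : L2Time T V × L2Time T H × H}
    (hx : IsTestTriple j hT x) (hy : IsTestTriple j hT y) : IsTestTriple j hT (x + y) := by
  obtain ⟨h1, P, h2, h3, h4⟩ := hx
  obtain ⟨k1, Q, k2, k3, k4⟩ := hy
  have hi : ∀ u : L2Time T V, IntegrableOn (fun t => j (u t)) (Ioo 0 T) := fun u =>
    j.integrable_comp (integrableOn_coeFn u)
  refine ⟨(h1.add k1 (hi _) (hi _) (integrableOn_coeFn _) (integrableOn_coeFn _)).congr ?_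
    (Lp.coeFn_add _ _).symm, P + Q, ?_, by simp [h3, k3], by simp [h4, k4]⟩
  · filter_upwards [Lp.coeFn_add x.1 y.1] with t ht
    rw [Prod.fst_add, ht, Pi.add_apply, Pi.add_apply, map_add]
  · filter_upwards [h2, k2, Lp.coeFn_add x.1 y.1] with t e1 e2 e3 ht
    rw [Prod.fst_add, e3, Pi.add_apply, map_add, ← e1 ht, ← e2 ht]; rfl

theorem IsTestTriple.smul {hT : 0 < T} {x : L2Time T V × L2Time T H × H}
    (hx : IsTestTriple j hT x) (r : ℝ) : IsTestTriple j hT (r • x) := by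
  obtain ⟨h1, P, h2, h3, h4⟩ := hx
  refine ⟨(h1.const_smul r).congr ?_ (Lp.coeFn_smul _ _).symm, r • P, ?_, by simp [h3],
    by simp [h4]⟩
  · filter_upwards [Lp.coeFn_smul r x.1] with t ht
    rw [Prod.smul_fst, ht, Pi.smul_apply, Pi.smul_apply, map_smul]
  · filter_upwards [h2, Lp.coeFn_smul r x.1] with t e1 e2 ht
    rw [Prod.smul_fst, e2, Pi.smul_apply, map_smul, ← e1 ht]; rfl

theorem memLp_smul_const {θ : ℝ → ℝ} (hθ : Continuous θ) (w : V) :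
    MemLp (fun t => θ t • w) 2 (volTime T) :=
  memLp_smul_of_continuous hθ (memLp_const w)

/-- Test functions `θ(t) w` with separated variables. -/
theorem isTestTriple_tensor [CompleteSpace H] (j : V →L[ℝ] H) (hT : 0 < T) {θ : ℝ → ℝ}
    (hθ : ContDiff ℝ 1 θ) (hθT : θ T = 0) (w : V) :
    IsTestTriple j hT ((memLp_smul_const hθ.continuous w).toLp _,
      (memLp_smul_const (hθ.continuous_deriv le_rfl) (j w)).toLp _, θ 0 • j w) := by
  have hd := hθ.continuous_deriv le_rfl
  have hint : IntegrableOn (fun t => deriv θ t • j w) (Ioo 0 T) :=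
    (memLp_smul_const hd (j w)).integrable (by norm_num)
  have hprim : ∀ t, θ 0 • j w + ∫ s in (0 : ℝ)..t, deriv θ s • j w = θ t • j w := fun t => by
    rw [intervalIntegral.integral_smul_const, intervalIntegral.integral_deriv_eq_sub
      (fun x _ => hθ.differentiable one_ne_zero x) (hd.intervalIntegrable _ _), sub_smul]
    abel
  have key : IsWeakTimeDeriv T (fun t => θ t • j w) (fun t => deriv θ t • j w) := by
    intro η h1 h2 h3
    have e := integral_deriv_smul_primitive hT.le hint (θ 0 • j w)
      (h1.of_le (by exact_mod_cast le_top))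
    have z0 : η 0 = 0 := image_eq_zero_of_notMem_tsupport fun h => (h3 h).1.false
    have zT : η T = 0 := image_eq_zero_of_notMem_tsupport fun h => (h3 h).2.false
    simp only [hprim, z0, zT, zero_smul, sub_zero] at e
    exact eq_neg_of_add_eq_zero_left e
  have hc := hθ.continuous
  refine ⟨key.congr ?_ ((memLp_smul_const (T := T) hd (j w)).coeFn_toLp).symm,
    ⟨fun t => θ t • j w, by fun_prop⟩, ?_, ?_, rfl⟩
  · filter_upwards [(memLp_smul_const (T := T) hc w).coeFn_toLp] with t e
    rw [e, map_smul]
  · filter_upwards [(memLp_smul_const (T := T) hc w).coeFn_toLp] with t e ht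
    rw [e, map_smul]; rfl
  · change θ T • j w = 0
    rw [hθT, zero_smul]

end TestTriple

end

/-! ### Weak evolution equations for a Hilbert pair -/

section

open ContinuousLinearMap (adjoint)

variable {T : ℝ} {hT : 0 < T}

theorem norm_sq_eq_intervalIntegral {E : Type} [NormedAddCommGroup E] [InnerProductSpace ℝ E]
    (hT : 0 ≤ T) (u : L2Time T E) : ‖u‖ ^ 2 = ∫ t in (0 : ℝ)..T, ‖u t‖ ^ 2 := by
  rw [← real_inner_self_eq_norm_sq, L2.inner_def, setIntegral_Ioo_eq_intervalIntegral hT]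
  simp only [real_inner_self_eq_norm_sq]

theorem inner_adjoint_compLpL {V H : Type} [NormedAddCommGroup V] [InnerProductSpace ℝ V]
    [CompleteSpace V] [NormedAddCommGroup H] [InnerProductSpace ℝ H] [CompleteSpace H]
    (L : V →L[ℝ] H) (y : L2Time T H) (u : L2Time T V) :
    inner ℝ ((adjoint L).compLpL 2 (volTime T) y) u = inner ℝ y (L.compLpL 2 (volTime T) u) := by
  rw [L2.inner_def, L2.inner_def]
  refine integral_congr_ae ?_
  filter_upwards [(adjoint L).coeFn_compLpL (p := 2) y, L.coeFn_compLpL (p := 2) u] with t e1 e2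
  rw [e1, e2, ContinuousLinearMap.adjoint_inner_left]

/-- Two continuous functions on `[0,T]` that represent the same class coincide. -/
theorem continuousMap_ext_of_ae {H : Type} [NormedAddCommGroup H] (hT : 0 < T) {u : ℝ → H}
    {P Q : C(Icc (0 : ℝ) T, H)}
    (hP : ∀ᵐ t ∂volTime T, ∀ ht : t ∈ Icc (0 : ℝ) T, P ⟨t, ht⟩ = u t)
    (hQ : ∀ᵐ t ∂volTime T, ∀ ht : t ∈ Icc (0 : ℝ) T, Q ⟨t, ht⟩ = u t) : P = Q := by
  refine DFunLike.coe_injective (Continuous.ext_on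
    (dense_setOf_mem_Icc_of_ae hT (hP.and hQ)) P.continuous Q.continuous ?_)
  rintro ⟨t, ht⟩ ⟨-, h1, h2⟩
  exact (h1 ht).trans (h2 ht).symm

/-- **Lions' projection theorem**, in the form used here: a linear functional `ℓ` that is bounded by
`‖K x‖` is represented by pairing `K x` with some vector. Indeed `K x ↦ ℓ x` is a bounded functional on the
range of `K`, which extends to `𝓥` by the Hahn–Banach theorem. -/
theorem exists_forall_inner_eq {X 𝓥 : Type*} [AddCommGroup X] [Module ℝ X]
    [NormedAddCommGroup 𝓥] [InnerProductSpace ℝ 𝓥] [CompleteSpace 𝓥] (K : X →ₗ[ℝ] 𝓥)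
    (l : X →ₗ[ℝ] ℝ) (C : ℝ) (hC : ∀ x, |l x| ≤ C * ‖K x‖) :
    ∃ u : 𝓥, ∀ x, inner ℝ u (K x) = l x := by
  obtain ⟨σ, hσ⟩ := K.rangeRestrict.exists_rightInverse_of_surjective K.range_rangeRestrict
  have hKσ : ∀ y, K (σ y) = y := fun y => congrArg Subtype.val (LinearMap.congr_fun hσ y)
  obtain ⟨g, hg, -⟩ := exists_extension_norm_eq K.range
    ((l.comp σ).mkContinuous C fun y => by
      have := hC (σ y)
      rwa [hKσ] at this)
  refine ⟨(InnerProductSpace.toDual ℝ 𝓥).symm g, fun x => ?_⟩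
  rw [InnerProductSpace.toDual_symm_apply]
  have h1 := hg ⟨K x, x, rfl⟩
  rw [h1]
  change l (σ ⟨K x, x, rfl⟩) = l x
  have h2 := hC (σ ⟨K x, x, rfl⟩ - x)
  rw [map_sub K, hKσ, sub_self, norm_zero, mul_zero, map_sub] at h2
  exact sub_eq_zero.1 (abs_nonpos_iff.1 h2)

variable {V H : Type} [NormedAddCommGroup V] [InnerProductSpace ℝ V] [NormedAddCommGroup H]
  [InnerProductSpace ℝ H] {j S : V →L[ℝ] H}

/-- The weak form of `u_t = h`, `u(0) = p₀` for `u ∈ L²(0,T;V)`, where `h(t) ∈ V'` is represented by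
an element of `V`: `-∫⟨φ_t, u⟩ = ⟨p₀, φ(0)⟩ + ∫⟨h, φ⟩` for all test functions `φ`. -/
def IsWeakEvolution (j : V →L[ℝ] H) (hT : 0 < T) (p₀ : H) (u h : L2Time T V) : Prop :=
  ∀ x : L2Time T V × L2Time T H × H, IsTestTriple j hT x →
    -inner ℝ x.2.1 (j.compLpL 2 (volTime T) u) = inner ℝ p₀ x.2.2 + inner ℝ h x.1

theorem IsWeakEvolution.sub {p₀ q₀ : H} {u w h k : L2Time T V}
    (h1 : IsWeakEvolution j hT p₀ u h) (h2 : IsWeakEvolution j hT q₀ w k) :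
    IsWeakEvolution j hT (p₀ - q₀) (u - w) (h - k) := fun x hx => by
  have e1 := h1 x hx
  have e2 := h2 x hx
  rw [map_sub, inner_sub_right, inner_sub_left, inner_sub_left]
  linarith

theorem norm_sq_eq_compLpL_add (hT : 0 < T) (hV : ∀ u : V, ‖u‖ ^ 2 = ‖j u‖ ^ 2 + ‖S u‖ ^ 2)
    (u : L2Time T V) :
    ‖u‖ ^ 2 = ‖j.compLpL 2 (volTime T) u‖ ^ 2 + ‖S.compLpL 2 (volTime T) u‖ ^ 2 := by
  have sq_int : ∀ {E : Type} [NormedAddCommGroup E] (u : L2Time T E),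
      IntervalIntegrable (fun t => ‖u t‖ ^ 2) volume 0 T := fun {E _} u =>
    intervalIntegrable_of_integrableOn_Ioo ((Lp.memLp u).integrable_norm_pow (by norm_num))
      (left_mem_Icc.2 hT.le) (right_mem_Icc.2 hT.le)
  rw [norm_sq_eq_intervalIntegral hT.le, norm_sq_eq_intervalIntegral hT.le,
    norm_sq_eq_intervalIntegral hT.le, ← intervalIntegral.integral_add (sq_int _) (sq_int _),
    ← setIntegral_Ioo_eq_intervalIntegral hT.le, ← setIntegral_Ioo_eq_intervalIntegral hT.le]
  refine integral_congr_ae ?_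
  filter_upwards [j.coeFn_compLpL (p := 2) u, S.coeFn_compLpL (p := 2) u] with t e1 e2
  rw [e1, e2, hV]

variable [CompleteSpace H]

/-- The energy identity for test functions, which vanish at time `T`. -/
theorem IsTestTriple.inner_self {x : L2Time T V × L2Time T H × H} (hx : IsTestTriple j hT x) :
    2 * inner ℝ x.2.1 (j.compLpL 2 (volTime T) x.1) = -‖x.2.2‖ ^ 2 := by
  obtain ⟨φ, g, y⟩ := x
  obtain ⟨hd, Q, h1, h2, h3⟩ := hx
  simp only at hd h1 h2 h3 ⊢
  have hweak : IsWeakTimeDeriv T (fun t => adjoint (ContinuousLinearMap.id ℝ H)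
      (ContinuousLinearMap.id ℝ H (j (φ t)))) (fun t => g t) := by
    rw [ContinuousLinearMap.adjoint_id]
    exact hd
  obtain ⟨P, k1, -, k3⟩ := exists_continuous_rep_of_weakDeriv (u := fun t => j (φ t))
    (ContinuousLinearMap.id ℝ H) (fun _ _ h => h) hT (j.comp_memLp' (Lp.memLp φ)) (Lp.memLp g) hweak
  have hP : P = Q := continuousMap_ext_of_ae hT k1 h1
  have e := k3 ⟨T, right_mem_Icc.2 hT.le⟩
  rw [hP, h2, h3, norm_zero] at e
  have e2 : inner ℝ g (j.compLpL 2 (volTime T) φ)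
      = ∫ s in (0 : ℝ)..T, inner ℝ (g s) (j (φ s)) := by
    rw [L2.inner_def, ← setIntegral_Ioo_eq_intervalIntegral hT.le]
    refine integral_congr_ae ?_
    filter_upwards [j.coeFn_compLpL (p := 2) φ] with t ht
    rw [ht]
  rw [e2]
  linarith

variable [CompleteSpace V]

/-- Testing with functions with separated variables `θ(t) w`. -/
theorem IsWeakEvolution.inner_tensor {p₀ : H} {u h : L2Time T V}
    (huh : IsWeakEvolution j hT p₀ u h) {θ : ℝ → ℝ} (hθ : ContDiff ℝ 1 θ) (hθT : θ T = 0)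
    (w : V) :
    -inner ℝ w (∫ t in Ioo 0 T, deriv θ t • adjoint j (j (u t)))
      = θ 0 * inner ℝ p₀ (j w) + inner ℝ w (∫ t in Ioo 0 T, θ t • h t) := by
  have hd := hθ.continuous_deriv le_rfl
  have e := huh _ (isTestTriple_tensor j hT hθ hθT w)
  simp only at e
  have i1 : IntegrableOn (fun t => deriv θ t • adjoint j (j (u t))) (Ioo 0 T) :=
    integrableOn_smul_of_continuous hd
      (((adjoint j).comp j).integrable_comp (integrableOn_coeFn u))
  have i2 : IntegrableOn (fun t => θ t • h t) (Ioo 0 T) :=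
    integrableOn_smul_of_continuous hθ.continuous (integrableOn_coeFn h)
  rw [← integral_inner i1, ← integral_inner i2, ← real_inner_smul_right]
  rw [L2.inner_def, L2.inner_def] at e
  have e1 : ∫ t in Ioo 0 T, inner ℝ w (deriv θ t • adjoint j (j (u t)))
      = ∫ t in Ioo 0 T, inner ℝ ((memLp_smul_const (T := T) hd (j w)).toLp _ t)
        (j.compLpL 2 (volTime T) u t) := by
    refine integral_congr_ae ?_
    filter_upwards [j.coeFn_compLpL (p := 2) u,
      (memLp_smul_const (T := T) hd (j w)).coeFn_toLp] with t h1 h2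
    rw [h1, h2, real_inner_smul_right, ContinuousLinearMap.adjoint_inner_right,
      ← real_inner_smul_left]
  have e2 : ∫ t in Ioo 0 T, inner ℝ w (θ t • h t)
      = ∫ t in Ioo 0 T, inner ℝ (h t) ((memLp_smul_const (T := T) hθ.continuous w).toLp _ t) := by
    refine integral_congr_ae ?_
    filter_upwards [(memLp_smul_const (T := T) hθ.continuous w).coeFn_toLp] with t h2
    rw [h2, real_inner_smul_right, real_inner_comm, real_inner_smul_right]
  rw [e1, e2]
  exact e

theorem IsWeakEvolution.isWeakTimeDeriv {p₀ : H} {u h : L2Time T V}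
    (huh : IsWeakEvolution j hT p₀ u h) :
    IsWeakTimeDeriv T (fun t => adjoint j (j (u t))) h := by
  intro θ h1 h2 h3
  refine ext_inner_left ℝ fun w => ?_
  have z0 : θ 0 = 0 := image_eq_zero_of_notMem_tsupport fun h => (h3 h).1.false
  have zT : θ T = 0 := image_eq_zero_of_notMem_tsupport fun h => (h3 h).2.false
  have e := huh.inner_tensor (h1.of_le (by exact_mod_cast le_top)) zT w
  rw [z0, zero_mul, zero_add] at e
  rw [inner_neg_right, ← e, neg_neg]

/-- The solution of a weak evolution equation is continuous with values in `H`, attains its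
initial value, and satisfies the energy identity. -/
theorem IsWeakEvolution.exists_contRep (hj : Function.Injective j)
    (hd : ∀ y : H, (∀ w, inner ℝ y (j w) = 0) → y = 0) {p₀ : H}
    {u h : L2Time T V} (huh : IsWeakEvolution j hT p₀ u h) :
    ∃ P : C(Icc (0 : ℝ) T, H),
      (∀ᵐ t ∂volTime T, ∀ ht : t ∈ Icc (0 : ℝ) T, P ⟨t, ht⟩ = j (u t)) ∧
      ∀ t : Icc (0 : ℝ) T,
        ‖P t‖ ^ 2 = ‖p₀‖ ^ 2 + 2 * ∫ s in (0 : ℝ)..t, inner ℝ (h s) (u s) := by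
  obtain ⟨P, h1, h2, h3⟩ := exists_continuous_rep_of_weakDeriv j hj hT
    (Lp.memLp u) (Lp.memLp h) huh.isWeakTimeDeriv
  set P₀ := P ⟨0, left_mem_Icc.2 hT.le⟩
  suffices hP₀ : P₀ = p₀ from ⟨P, h1, fun t => by rw [h3, hP₀]⟩
  rw [← sub_eq_zero]
  refine hd _ fun w => ?_
  -- test with `(T - t) w` and integrate by parts
  have hθ : ContDiff ℝ 1 fun t : ℝ => T - t := contDiff_const.sub contDiff_id
  have e1 := huh.inner_tensor hθ (sub_self T) w
  have e2 := integral_deriv_smul_primitive hT.le (integrableOn_coeFn h) (adjoint j P₀) hθ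
  have e3 : ∫ t in Ioo 0 T, deriv (fun t : ℝ => T - t) t • adjoint j (j (u t))
      = ∫ t in Ioo 0 T, deriv (fun t : ℝ => T - t) t
        • (adjoint j P₀ + ∫ s in (0 : ℝ)..t, h s) := by
    refine integral_congr_ae ?_
    filter_upwards [h1, ae_restrict_mem measurableSet_Ioo] with t k1 k2
    rw [← k1 (Ioo_subset_Icc_self k2), h2]
  rw [e3, eq_sub_of_add_eq e2] at e1
  simp only [sub_self, zero_smul, sub_zero, inner_sub_right, zero_sub, inner_neg_right,
    real_inner_smul_right, ContinuousLinearMap.adjoint_inner_right] at e1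
  have e4 : T * inner ℝ (j w) P₀ = T * inner ℝ p₀ (j w) := by linarith
  rw [inner_sub_left, real_inner_comm, mul_left_cancel₀ hT.ne' e4, sub_self]

/-- The functional `φ ↦ ⟨F, φ⟩ - ⟨S z, S φ⟩ - r ⟨j z, j φ⟩ + ⟨M (j z), j φ⟩`, represented in
`L²(0,T;V)`. -/
def source (j S : V →L[ℝ] H) (M : L2Time T H →L[ℝ] L2Time T H) (r : ℝ) (F z : L2Time T V) :
    L2Time T V :=
  F - (adjoint S).compLpL 2 (volTime T) (S.compLpL 2 (volTime T) z)
    - r • (adjoint j).compLpL 2 (volTime T) (j.compLpL 2 (volTime T) z)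
    + (adjoint j).compLpL 2 (volTime T) (M (j.compLpL 2 (volTime T) z))

theorem inner_source (M : L2Time T H →L[ℝ] L2Time T H) (r : ℝ) (F z φ : L2Time T V) :
    inner ℝ (source j S M r F z) φ = inner ℝ F φ
      - inner ℝ (S.compLpL 2 (volTime T) z) (S.compLpL 2 (volTime T) φ)
      - r * inner ℝ (j.compLpL 2 (volTime T) z) (j.compLpL 2 (volTime T) φ)
      + inner ℝ (M (j.compLpL 2 (volTime T) z)) (j.compLpL 2 (volTime T) φ) := by
  rw [source, inner_add_left, inner_sub_left, inner_sub_left, real_inner_smul_left,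
    inner_adjoint_compLpL, inner_adjoint_compLpL, inner_adjoint_compLpL]

theorem source_sub (M : L2Time T H →L[ℝ] L2Time T H) (r : ℝ) (F G z w : L2Time T V) :
    source j S M r F z - source j S M r G w = source j S M r (F - G) (z - w) := by
  simp only [source, map_sub, smul_sub]
  abel

theorem inner_source_apply (M : L2Time T H →L[ℝ] L2Time T H) (r : ℝ)
    (F z : L2Time T V) : ∀ᵐ t ∂volTime T, inner ℝ (source j S M r F z t) (z t)
      = inner ℝ (F t) (z t) - ‖S (z t)‖ ^ 2 - r * ‖j (z t)‖ ^ 2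
        + inner ℝ (M (j.compLpL 2 (volTime T) z) t) (j.compLpL 2 (volTime T) z t) := by
  set A := (adjoint S).compLpL 2 (volTime T) (S.compLpL 2 (volTime T) z) with hA
  set B := (adjoint j).compLpL 2 (volTime T) (j.compLpL 2 (volTime T) z) with hB
  set D := (adjoint j).compLpL 2 (volTime T) (M (j.compLpL 2 (volTime T) z)) with hD
  filter_upwards [Lp.coeFn_add (F - A - r • B) D, Lp.coeFn_sub (F - A) (r • B), Lp.coeFn_sub F A,
    Lp.coeFn_smul r B, (adjoint S).coeFn_compLpL (p := 2) (S.compLpL 2 (volTime T) z),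
    (adjoint j).coeFn_compLpL (p := 2) (j.compLpL 2 (volTime T) z),
    (adjoint j).coeFn_compLpL (p := 2) (M (j.compLpL 2 (volTime T) z)),
    j.coeFn_compLpL (p := 2) z, S.coeFn_compLpL (p := 2) z] with t e1 e2 e3 e4 e5 e6 e7 e8 e9
  have : source j S M r F z = F - A - r • B + D := rfl
  rw [this, e1, Pi.add_apply, e2, Pi.sub_apply, e3, Pi.sub_apply, e4, Pi.smul_apply, hA, e5, hB, e6,
    hD, e7, inner_add_left, inner_sub_left, inner_sub_left, real_inner_smul_left,
    ContinuousLinearMap.adjoint_inner_left, ContinuousLinearMap.adjoint_inner_left,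
    ContinuousLinearMap.adjoint_inner_left, e9, e8, real_inner_self_eq_norm_sq,
    real_inner_self_eq_norm_sq]

/-- **Energy estimate** for the coercive problem `r = C + 1`. -/
theorem IsWeakEvolution.exists_contRep_norm_le (hj : Function.Injective j)
    (hd : ∀ y : H, (∀ w, inner ℝ y (j w) = 0) → y = 0)
    (hV : ∀ u : V, ‖u‖ ^ 2 = ‖j u‖ ^ 2 + ‖S u‖ ^ 2) {p₀ : H}
    {M : L2Time T H →L[ℝ] L2Time T H} {C : ℝ}
    (hM : ∀ y, ∀ t ∈ Icc 0 T, ∫ s in (0 : ℝ)..t, inner ℝ (M y s) (y s)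
      ≤ C * ∫ s in (0 : ℝ)..t, ‖y s‖ ^ 2) {F z : L2Time T V}
    (hz : IsWeakEvolution j hT p₀ z (source j S M (C + 1) F z)) :
    ∃ P : C(Icc (0 : ℝ) T, H),
      (∀ᵐ t ∂volTime T, ∀ ht : t ∈ Icc (0 : ℝ) T, P ⟨t, ht⟩ = j (z t)) ∧
      ‖P‖ ≤ ‖p₀‖ + ‖F‖ ∧ ‖z‖ ≤ ‖p₀‖ + ‖F‖ := by
  obtain ⟨P, hP, hE⟩ := hz.exists_contRep hj hd
  set y := j.compLpL 2 (volTime T) z with hy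
  have zero_mem : (0 : ℝ) ∈ Icc 0 T := left_mem_Icc.2 hT.le
  have sq_int : ∀ {E : Type} [NormedAddCommGroup E] (u : L2Time T E),
      IntegrableOn (fun t => ‖u t‖ ^ 2) (Ioo 0 T) := fun {E _} u =>
    (Lp.memLp u).integrable_norm_pow (by norm_num)
  have main : ∀ t : Icc (0 : ℝ) T,
      ‖P t‖ ^ 2 + ∫ s in (0 : ℝ)..t, ‖z s‖ ^ 2 ≤ ‖p₀‖ ^ 2 + ‖F‖ ^ 2 := by
    intro t
    have ii : ∀ {f : ℝ → ℝ}, IntegrableOn f (Ioo 0 T) → IntervalIntegrable f volume 0 t :=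
      fun hf => intervalIntegrable_of_integrableOn_Ioo hf zero_mem t.2
    have i1 := ii (L2.integrable_inner (𝕜 := ℝ) (source j S M (C + 1) F z) z)
    have i2 := ii (L2.integrable_inner (𝕜 := ℝ) (M y) y)
    have i3 := ii (sq_int y)
    have i4 := ii (sq_int F)
    have i5 := ii (sq_int z)
    have hmono : ∫ s in (0 : ℝ)..t, ((2 * inner ℝ (source j S M (C + 1) F z s) (z s)
          - 2 * inner ℝ (M y s) (y s)) + 2 * C * ‖y s‖ ^ 2)
        ≤ ∫ s in (0 : ℝ)..t, (‖F s‖ ^ 2 - ‖z s‖ ^ 2) := by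
      refine intervalIntegral.integral_mono_ae_restrict t.2.1
        (((i1.const_mul 2).sub (i2.const_mul 2)).add (i3.const_mul (2 * C))) (i4.sub i5) ?_
      have hle : volume.restrict (Icc 0 (t : ℝ)) ≤ volTime T := by
        rw [← restrict_Ioo_eq_restrict_Icc]
        exact Measure.restrict_mono (Ioo_subset_Ioo_right t.2.2) le_rfl
      filter_upwards [ae_mono hle (inner_source_apply M (C + 1) F z),
        ae_mono hle (j.coeFn_compLpL (p := 2) z)] with s e1 e2
      have e3 := hV (z s)
      have e4 : inner ℝ (F s) (z s) ≤ ‖F s‖ * ‖z s‖ := real_inner_le_norm _ _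
      have e5 := sq_nonneg (‖F s‖ - ‖z s‖)
      rw [e1, ← hy]
      rw [← hy] at e2
      have e6 : ‖y s‖ = ‖j (z s)‖ := by rw [e2]
      rw [e6]
      nlinarith [sq_nonneg ‖S (z s)‖]
    rw [intervalIntegral.integral_add ((i1.const_mul 2).sub (i2.const_mul 2)) (i3.const_mul _),
      intervalIntegral.integral_sub (i1.const_mul 2) (i2.const_mul 2),
      intervalIntegral.integral_sub i4 i5, intervalIntegral.integral_const_mul,
      intervalIntegral.integral_const_mul, intervalIntegral.integral_const_mul] at hmono
    have hF : ∫ s in (0 : ℝ)..t, ‖F s‖ ^ 2 ≤ ‖F‖ ^ 2 := by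
      rw [norm_sq_eq_intervalIntegral hT.le]
      exact intervalIntegral.integral_mono_interval le_rfl t.2.1 t.2.2
        (Eventually.of_forall fun s => by positivity)
        (intervalIntegrable_of_integrableOn_Ioo (sq_int F) zero_mem (right_mem_Icc.2 hT.le))
    have h1 := hM y t t.2
    have h2 := hE t
    linarith
  have hsq : ‖p₀‖ ^ 2 + ‖F‖ ^ 2 ≤ (‖p₀‖ + ‖F‖) ^ 2 := by
    nlinarith [mul_nonneg (norm_nonneg p₀) (norm_nonneg F)]
  refine ⟨P, hP, ?_, ?_⟩
  · refine (ContinuousMap.norm_le _ (by positivity)).2 fun t => ?_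
    refine (sq_le_sq₀ (norm_nonneg _) (by positivity)).1 ?_
    have h1 := main t
    have h2 : 0 ≤ ∫ s in (0 : ℝ)..t, ‖z s‖ ^ 2 :=
      intervalIntegral.integral_nonneg t.2.1 fun s _ => by positivity
    linarith
  · refine (sq_le_sq₀ (norm_nonneg _) (by positivity)).1 ?_
    have h1 := main ⟨T, right_mem_Icc.2 hT.le⟩
    rw [← norm_sq_eq_intervalIntegral hT.le] at h1
    have h2 := sq_nonneg ‖P ⟨T, right_mem_Icc.2 hT.le⟩‖
    linarith

/-- Existence for the coercive problem, by Lions' projection theorem. -/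
theorem exists_isWeakEvolution (hT : 0 < T) (hV : ∀ u : V, ‖u‖ ^ 2 = ‖j u‖ ^ 2 + ‖S u‖ ^ 2)
    (p₀ : H) {M : L2Time T H →L[ℝ] L2Time T H} {C : ℝ}
    (hM : ∀ y, ∀ t ∈ Icc 0 T, ∫ s in (0 : ℝ)..t, inner ℝ (M y s) (y s)
      ≤ C * ∫ s in (0 : ℝ)..t, ‖y s‖ ^ 2) (F : L2Time T V) :
    ∃ z, IsWeakEvolution j hT p₀ z (source j S M (C + 1) F z) := by
  let Φ : Submodule ℝ (L2Time T V × L2Time T H × H) :=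
    { carrier := {x | IsTestTriple j hT x}
      add_mem' := fun hx hy => IsTestTriple.add (hT := hT) hx hy
      zero_mem' := by
        have := (isTestTriple_tensor j hT (contDiff_const (c := (0 : ℝ))) rfl 0).smul 0
        rwa [zero_smul] at this
      smul_mem' := fun r _ hx => IsTestTriple.smul (hT := hT) hx r }
  set J : L2Time T V →L[ℝ] L2Time T H := j.compLpL 2 (volTime T) with hJ
  set D : L2Time T V →L[ℝ] L2Time T H := S.compLpL 2 (volTime T) with hD
  -- the adjoint problem `K φ = -φ_t + S* S φ + (C + 1) φ - M* φ`
  set K : (L2Time T V × L2Time T H × H) →ₗ[ℝ] L2Time T V :=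
    (((adjoint D).comp D + (C + 1) • (adjoint J).comp J - (adjoint J).comp ((adjoint M).comp J) :
      L2Time T V →L[ℝ] L2Time T V) : L2Time T V →ₗ[ℝ] L2Time T V).comp
        (LinearMap.fst ℝ _ _)
      - (adjoint J : L2Time T H →ₗ[ℝ] L2Time T V).comp
        ((LinearMap.fst ℝ _ _).comp (LinearMap.snd ℝ _ _)) with hK
  have hKin : ∀ (z : L2Time T V) (x : L2Time T V × L2Time T H × H),
      inner ℝ z (K x) = inner ℝ (D z) (D x.1) + (C + 1) * inner ℝ (J z) (J x.1)
        - inner ℝ (M (J z)) (J x.1) - inner ℝ (J z) x.2.1 := by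
    intro z x
    have : K x = adjoint D (D x.1) + (C + 1) • adjoint J (J x.1)
      - adjoint J (adjoint M (J x.1)) - adjoint J x.2.1 := rfl
    rw [this, inner_sub_right, inner_sub_right, inner_add_right, real_inner_smul_right]
    simp only [ContinuousLinearMap.adjoint_inner_right]
  set l : (L2Time T V × L2Time T H × H) →ₗ[ℝ] ℝ :=
    (innerSL ℝ p₀ : H →ₗ[ℝ] ℝ).comp ((LinearMap.snd ℝ _ _).comp (LinearMap.snd ℝ _ _))
      + (innerSL ℝ F : L2Time T V →ₗ[ℝ] ℝ).comp (LinearMap.fst ℝ _ _) with hl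
  have hlin : ∀ x, l x = inner ℝ p₀ x.2.2 + inner ℝ F x.1 := fun x => rfl
  -- `⟨φ, K φ⟩ = ‖φ‖² + ‖φ(0)‖² / 2 + C ‖j φ‖² - ⟨M (j φ), j φ⟩` by the energy identity for `φ`
  have hcoer : ∀ x, IsTestTriple j hT x →
      ‖x.2.2‖ ^ 2 / 2 + ‖x.1‖ ^ 2 ≤ ‖K x‖ * ‖x.1‖ := by
    intro x hx
    have h1 := real_inner_le_norm x.1 (K x)
    rw [hKin, real_inner_self_eq_norm_sq, real_inner_self_eq_norm_sq,
      real_inner_comm x.2.1] at h1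
    have h2 := hx.inner_self
    have h3 := hM (J x.1) T (right_mem_Icc.2 hT.le)
    rw [← norm_sq_eq_intervalIntegral hT.le, ← setIntegral_Ioo_eq_intervalIntegral hT.le,
      ← L2.inner_def] at h3
    have h4 := norm_sq_eq_compLpL_add hT hV x.1
    linarith
  obtain ⟨z, hz⟩ := exists_forall_inner_eq (K.comp Φ.subtype) (l.comp Φ.subtype)
    (2 * ‖p₀‖ + ‖F‖) (by
      rintro ⟨x, hx⟩
      change |l x| ≤ (2 * ‖p₀‖ + ‖F‖) * ‖K x‖
      rw [hlin]
      set k := ‖K x‖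
      have hk : 0 ≤ k := norm_nonneg _
      have h1 := hcoer x hx
      have h2 : ‖x.1‖ ≤ k := by
        by_contra hlt
        push Not at hlt
        nlinarith [norm_nonneg x.1, sq_nonneg ‖x.2.2‖]
      have h3 : ‖x.2.2‖ ≤ 2 * k := by
        refine (sq_le_sq₀ (norm_nonneg _) (by positivity)).1 ?_
        nlinarith [norm_nonneg x.1, sq_nonneg ‖x.1‖]
      have h4 := abs_real_inner_le_norm p₀ x.2.2
      have h5 := abs_real_inner_le_norm F x.1
      have h6 := abs_add_le (inner ℝ p₀ x.2.2) (inner ℝ F x.1)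
      have h7 := mul_le_mul_of_nonneg_left h3 (norm_nonneg p₀)
      have h8 := mul_le_mul_of_nonneg_left h2 (norm_nonneg F)
      linarith)
  refine ⟨z, fun x hx => ?_⟩
  have e : inner ℝ z (K x) = l x := hz ⟨x, hx⟩
  rw [hKin, hlin, real_inner_comm x.2.1] at e
  rw [inner_source]
  linarith

end

/-! ### The exponential change of unknown -/

section

variable {T : ℝ} {hT : 0 < T} {V H : Type} [NormedAddCommGroup V] [InnerProductSpace ℝ V]
  [NormedAddCommGroup H] [InnerProductSpace ℝ H] {j S : V →L[ℝ] H}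

theorem inner_expWeight_right (μ : ℝ) (u w : L2Time T V) :
    inner ℝ u (expWeight μ w) = inner ℝ (expWeight μ u) w := by
  rw [L2.inner_def, L2.inner_def]
  refine integral_congr_ae ?_
  filter_upwards [coeFn_expWeight μ u, coeFn_expWeight μ w] with t e1 e2
  rw [e1, e2, real_inner_smul_left, real_inner_smul_right]

theorem compLpL_expWeight (L : V →L[ℝ] H) (μ : ℝ) (u : L2Time T V) :
    L.compLpL 2 (volTime T) (expWeight μ u) = expWeight μ (L.compLpL 2 (volTime T) u) := by
  refine Lp.ext ?_
  filter_upwards [coeFn_expWeight μ u, coeFn_expWeight μ (L.compLpL 2 (volTime T) u),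
    L.coeFn_compLpL (p := 2) u, L.coeFn_compLpL (p := 2) (expWeight μ u)] with t e1 e2 e3 e4
  rw [e4, e1, e2, e3, map_smul]

theorem expWeight_cancel {μ ν : ℝ} (h : μ + ν = 0) (u : L2Time T V) :
    expWeight μ (expWeight ν u) = u := by
  rw [expWeight_expWeight, h, expWeight_zero]

/-- If `φ` is a test function, so is `e^{μt} φ`, with time derivative
`e^{μt} φ_t + μ e^{μt} φ` and the same initial value. -/
theorem IsTestTriple.exp_mul {x : L2Time T V × L2Time T H × H} (hx : IsTestTriple j hT x)
    (μ : ℝ) : IsTestTriple j hT (expWeight μ x.1,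
      expWeight μ x.2.1 + μ • expWeight μ (j.compLpL 2 (volTime T) x.1), x.2.2) := by
  obtain ⟨h1, P, h2, h3, h4⟩ := hx
  refine ⟨(h1.exp_smul (j.integrable_comp (integrableOn_coeFn _)) (integrableOn_coeFn _) μ).congr
    ?_ ?_, ⟨fun t => Real.exp (μ * t) • P t, by fun_prop⟩, ?_, ?_, ?_⟩
  · filter_upwards [coeFn_expWeight μ x.1] with t e
    rw [e, map_smul]
  · filter_upwards [coeFn_expWeight μ x.2.1, j.coeFn_compLpL (p := 2) x.1,
      coeFn_expWeight μ (j.compLpL 2 (volTime T) x.1),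
      Lp.coeFn_smul μ (expWeight μ (j.compLpL 2 (volTime T) x.1)),
      Lp.coeFn_add (expWeight μ x.2.1)
        (μ • expWeight μ (j.compLpL 2 (volTime T) x.1))] with t e1 e2 e3 e4 e5
    rw [e5, Pi.add_apply, e4, Pi.smul_apply, e3, e2, e1]
  · filter_upwards [h2, coeFn_expWeight μ x.1] with t e1 e2 ht
    rw [e2, map_smul, ← e1 ht]; rfl
  · change Real.exp (μ * T) • P ⟨T, _⟩ = 0
    rw [h3, smul_zero]
  · change Real.exp (μ * 0) • P ⟨0, _⟩ = x.2.2
    rw [h4, mul_zero, Real.exp_zero, one_smul]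

variable [CompleteSpace V] [CompleteSpace H]

/-- `z` solves `z_t + S* S z + r z = M z + e^{-rt} F`, `z(0) = p₀` weakly. -/
def IsDampedEvolution (j S : V →L[ℝ] H) (M : L2Time T H →L[ℝ] L2Time T H) (hT : 0 < T) (r : ℝ)
    (F : L2Time T V) (p₀ : H) (z : L2Time T V) : Prop :=
  IsWeakEvolution j hT p₀ z (source j S M r (expWeight (-r) F) z)

variable {M : L2Time T H →L[ℝ] L2Time T H} {F : L2Time T V} {p₀ : H}

/-- Multiplication by `e^{(r - s)t}` turns solutions with parameter `r` into solutions with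
parameter `s`. -/
theorem IsDampedEvolution.exp_mul
    (hMe : ∀ (μ : ℝ) (y : L2Time T H), M (expWeight μ y) = expWeight μ (M y)) {r : ℝ}
    {z : L2Time T V} (hz : IsDampedEvolution j S M hT r F p₀ z) {s μ : ℝ} (hμ : r - s = μ) :
    IsDampedEvolution j S M hT s F p₀ (expWeight μ z) := by
  intro x hx
  have e := hz _ (hx.exp_mul μ)
  have hs : μ + -r = -s := by rw [← hμ]; ring
  simp only [inner_add_left, real_inner_smul_left, inner_source] at e ⊢
  simp only [compLpL_expWeight, hMe] at e ⊢
  simp only [inner_expWeight_right] at e ⊢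
  rw [expWeight_expWeight, hs, ← inner_expWeight_right μ (j.compLpL 2 (volTime T) x.1),
    real_inner_comm (expWeight μ (j.compLpL 2 (volTime T) z))] at e
  rw [← inner_expWeight_right] at e ⊢
  subst hμ
  linarith

/-- Well-posedness for every `r`, by reduction to the coercive case `r = C + 1`. -/
theorem existsUnique_isDampedEvolution (hT : 0 < T) (hj : Function.Injective j)
    (hd : ∀ y : H, (∀ w, inner ℝ y (j w) = 0) → y = 0)
    (hV : ∀ u : V, ‖u‖ ^ 2 = ‖j u‖ ^ 2 + ‖S u‖ ^ 2) {C : ℝ}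
    (hM : ∀ y, ∀ t ∈ Icc 0 T, ∫ s in (0 : ℝ)..t, inner ℝ (M y s) (y s)
      ≤ C * ∫ s in (0 : ℝ)..t, ‖y s‖ ^ 2)
    (hMe : ∀ (μ : ℝ) (y : L2Time T H), M (expWeight μ y) = expWeight μ (M y))
    (r : ℝ) (F : L2Time T V) (p₀ : H) : ∃! z, IsDampedEvolution j S M hT r F p₀ z := by
  obtain ⟨z, hz⟩ := exists_isWeakEvolution (j := j) (S := S) hT hV p₀ hM (expWeight (-(C + 1)) F)
  have hz' : IsDampedEvolution j S M hT (C + 1) F p₀ z := hz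
  refine ⟨expWeight (C + 1 - r) z, hz'.exp_mul hMe rfl, fun w hw => ?_⟩
  have hw' : IsDampedEvolution j S M hT (C + 1) F p₀ (expWeight (r - (C + 1)) w) :=
    hw.exp_mul hMe rfl
  have hdiff := hw'.sub hz'
  rw [source_sub, sub_self, sub_self] at hdiff
  obtain ⟨-, -, -, h0⟩ := hdiff.exists_contRep_norm_le hj hd hV hM
  rw [norm_zero, norm_zero, add_zero, norm_le_zero_iff, sub_eq_zero] at h0
  rw [← h0, expWeight_cancel (by ring)]

/-- The a priori estimate for `r = C + 1`, where the weight `e^{-rt}` is at most `1`. -/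
theorem IsDampedEvolution.exists_norm_add_norm_le (hj : Function.Injective j)
    (hd : ∀ y : H, (∀ w, inner ℝ y (j w) = 0) → y = 0)
    (hV : ∀ u : V, ‖u‖ ^ 2 = ‖j u‖ ^ 2 + ‖S u‖ ^ 2) {C : ℝ} (hC : 0 ≤ C)
    (hM : ∀ y, ∀ t ∈ Icc 0 T, ∫ s in (0 : ℝ)..t, inner ℝ (M y s) (y s)
      ≤ C * ∫ s in (0 : ℝ)..t, ‖y s‖ ^ 2) {z : L2Time T V}
    (hz : IsDampedEvolution j S M hT (C + 1) F p₀ z) :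
    ∃ P : C(Icc (0 : ℝ) T, H),
      (∀ᵐ t ∂volTime T, ∀ ht : t ∈ Icc (0 : ℝ) T, P ⟨t, ht⟩ = j (z t)) ∧
      ‖P‖ + ‖z‖ ≤ 2 * (‖p₀‖ + ‖F‖) := by
  obtain ⟨P, hP, h1, h2⟩ := IsWeakEvolution.exists_contRep_norm_le hj hd hV hM hz
  have h3 : ‖expWeight (-(C + 1)) F‖ ≤ 1 * ‖F‖ :=
    norm_expWeight_le (fun t ht => Real.exp_le_one_iff.2 (by nlinarith [ht.1])) F
  exact ⟨P, hP, by linarith⟩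

/-- The a priori estimate for `r = 0`, through the solution `e^{-(C+1)t} p` of the coercive
problem. -/
theorem IsDampedEvolution.exists_norm_add_norm_le_exp (hj : Function.Injective j)
    (hd : ∀ y : H, (∀ w, inner ℝ y (j w) = 0) → y = 0)
    (hV : ∀ u : V, ‖u‖ ^ 2 = ‖j u‖ ^ 2 + ‖S u‖ ^ 2) {C : ℝ} (hC : 0 ≤ C)
    (hM : ∀ y, ∀ t ∈ Icc 0 T, ∫ s in (0 : ℝ)..t, inner ℝ (M y s) (y s)
      ≤ C * ∫ s in (0 : ℝ)..t, ‖y s‖ ^ 2)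
    (hMe : ∀ (μ : ℝ) (y : L2Time T H), M (expWeight μ y) = expWeight μ (M y)) {p : L2Time T V}
    (hp : IsDampedEvolution j S M hT 0 F p₀ p) :
    ∃ P : C(Icc (0 : ℝ) T, H),
      (∀ᵐ t ∂volTime T, ∀ ht : t ∈ Icc (0 : ℝ) T, P ⟨t, ht⟩ = j (p t)) ∧
      ‖P‖ + ‖p‖ ≤ 2 * Real.exp ((C + 1) * T) * (‖p₀‖ + ‖F‖) := by
  have hz : IsDampedEvolution j S M hT (C + 1) F p₀
    (expWeight (-(C + 1)) p) := hp.exp_mul hMe (zero_sub _)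
  obtain ⟨Z, hZ, hle⟩ := hz.exists_norm_add_norm_le hj hd hV hC hM
  set z := expWeight (-(C + 1)) p with hzdef
  have hpz : expWeight (C + 1) z = p := expWeight_cancel (by ring) p
  have hexp : ∀ t, t ≤ T → Real.exp ((C + 1) * t) ≤ Real.exp ((C + 1) * T) := fun t ht =>
    Real.exp_le_exp.2 (mul_le_mul_of_nonneg_left ht (by linarith))
  refine ⟨⟨fun t => Real.exp ((C + 1) * t) • Z t, by fun_prop⟩, ?_, ?_⟩
  · filter_upwards [hZ, coeFn_expWeight (C + 1) z] with t e1 e2 ht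
    rw [← hpz, e2, map_smul, ← e1 ht]; rfl
  · have h1 : ‖p‖ ≤ Real.exp ((C + 1) * T) * ‖z‖ := by
      rw [← hpz]
      exact norm_expWeight_le (fun t ht => hexp t ht.2.le) z
    have h2 : ‖(⟨fun t => Real.exp ((C + 1) * t) • Z t, by fun_prop⟩ : C(Icc (0 : ℝ) T, H))‖
        ≤ Real.exp ((C + 1) * T) * ‖Z‖ := by
      refine (ContinuousMap.norm_le _ (by positivity)).2 fun t => ?_
      change ‖Real.exp ((C + 1) * t) • Z t‖ ≤ _
      rw [norm_smul, Real.norm_of_nonneg (Real.exp_pos _).le]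
      exact mul_le_mul (hexp t t.2.2) (Z.norm_coe_le_norm t) (norm_nonneg _) (Real.exp_pos _).le
    have h3 := mul_le_mul_of_nonneg_left hle (Real.exp_pos ((C + 1) * T)).le
    linarith

end

/-! ### Variational formulations written with integrals -/

section

section Abstract

variable {T : ℝ} {hT : 0 < T} {V H : Type} [NormedAddCommGroup V] [InnerProductSpace ℝ V]
  [NormedAddCommGroup H] [InnerProductSpace ℝ H] {j S : V →L[ℝ] H} [CompleteSpace V]

/-- The Riesz representative of `f ∈ L²(0,T;V')` in `L²(0,T;V)`. -/
theorem exists_riesz (f : L2Time T (StrongDual ℝ V)) : ∃ F : L2Time T V, ‖F‖ ≤ ‖f‖ ∧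
    ∀ᵐ t ∂volTime T, ∀ w : V, inner ℝ (F t) w = f t w := by
  have hm : MemLp (fun t => (InnerProductSpace.toDual ℝ V).symm (f t)) 2 (volTime T) :=
    (Lp.memLp f).of_le ((InnerProductSpace.toDual ℝ V).symm.continuous.comp_aestronglyMeasurable
      (Lp.aestronglyMeasurable f)) (Eventually.of_forall fun t => (LinearIsometryEquiv.norm_map _ _).le)
  refine ⟨hm.toLp _, ?_, ?_⟩
  · refine Lp.norm_le_norm_of_ae_le ?_
    filter_upwards [hm.coeFn_toLp] with t e
    rw [e, LinearIsometryEquiv.norm_map]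
  · filter_upwards [hm.coeFn_toLp] with t e w
    rw [e]
    exact InnerProductSpace.toDual_symm_apply

variable [CompleteSpace H]

/-- The solution of a weak evolution equation, embedded into `V'` through `H`, has its time
derivative in `L²(0,T;V')`. -/
theorem IsWeakEvolution.exists_dual_timeDeriv {p₀ : H} {u h : L2Time T V}
    (huh : IsWeakEvolution j hT p₀ u h) : ∃ g : L2Time T (StrongDual ℝ V),
      IsWeakTimeDeriv T (fun t => (innerSL ℝ (j (u t))).comp j) g := by
  set L : V →L[ℝ] StrongDual ℝ V := innerSL ℝ with hL
  refine ⟨L.compLpL 2 (volTime T) h, ?_⟩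
  refine (huh.isWeakTimeDeriv.clm_comp
    (((ContinuousLinearMap.adjoint j).comp j).integrable_comp (integrableOn_coeFn u))
    (integrableOn_coeFn h) L).congr (Eventually.of_forall fun t => ?_)
    (L.coeFn_compLpL (p := 2) h).symm
  ext w
  exact ContinuousLinearMap.adjoint_inner_left _ _ _

theorem variational_integral_iff {M : L2Time T H →L[ℝ] L2Time T H} {f : L2Time T (StrongDual ℝ V)}
    {F : L2Time T V} (hF : ∀ᵐ t ∂volTime T, ∀ w : V, inner ℝ (F t) w = f t w) (r : ℝ) (p₀ y : H)
    (z φ : L2Time T V) (g : L2Time T H) :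
    -(∫ t in Ioo 0 T, inner ℝ (g t) (j (z t)))
      + (∫ t in Ioo 0 T, inner ℝ (S (z t)) (S (φ t)))
      + r * (∫ t in Ioo 0 T, inner ℝ (j (z t)) (j (φ t)))
      - inner ℝ (M (j.compLpL 2 (volTime T) z)) (j.compLpL 2 (volTime T) φ)
        = inner ℝ p₀ y + ∫ t in Ioo 0 T, Real.exp (-r * t) * f t (φ t) ↔
      -inner ℝ g (j.compLpL 2 (volTime T) z) = inner ℝ p₀ y
        + inner ℝ (source j S M r (expWeight (-r) F) z) φ := by
  have cz := j.coeFn_compLpL (p := 2) z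
  have e1 : inner ℝ g (j.compLpL 2 (volTime T) z)
      = ∫ t in Ioo 0 T, inner ℝ (g t) (j (z t)) := by
    rw [L2.inner_def]
    exact integral_congr_ae (cz.mono fun t e => by simp only [e])
  have e2 : inner ℝ (S.compLpL 2 (volTime T) z) (S.compLpL 2 (volTime T) φ)
      = ∫ t in Ioo 0 T, inner ℝ (S (z t)) (S (φ t)) := by
    rw [L2.inner_def]
    refine integral_congr_ae ?_
    filter_upwards [S.coeFn_compLpL (p := 2) z, S.coeFn_compLpL (p := 2) φ] with t k1 k2
    rw [k1, k2]
  have e3 : inner ℝ (j.compLpL 2 (volTime T) z) (j.compLpL 2 (volTime T) φ)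
      = ∫ t in Ioo 0 T, inner ℝ (j (z t)) (j (φ t)) := by
    rw [L2.inner_def]
    refine integral_congr_ae ?_
    filter_upwards [cz, j.coeFn_compLpL (p := 2) φ] with t k1 k2
    rw [k1, k2]
  have e5 : inner ℝ (expWeight (-r) F) φ
      = ∫ t in Ioo 0 T, Real.exp (-r * t) * f t (φ t) := by
    rw [L2.inner_def]
    refine integral_congr_ae ?_
    filter_upwards [coeFn_expWeight (-r) F, hF] with t k1 k2
    rw [k1, real_inner_smul_left, k2]
  rw [inner_source, e1, e2, e3, e5]
  constructor <;> intro h <;> linarith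

end Abstract

/-! ### Application to the degenerate equation -/

variable {a : ℝ → ℝ} {T : ℝ} {hT : 0 < T} {ω : Set ℝ} {v : LInfControl T ω}

/-- An operator representing multiplication by `v χ_ω` commutes with multiplication by functions of
time. -/
theorem potential_expWeight (hω_sub : ω ⊆ Ioo (-1) 1) {M : L2Time T L2Ω →L[ℝ] L2Time T L2Ω}
    (hM : ∀ y z : ℝ → L2Ω, ∀ y' z' : L2Time T L2Ω, y =ᵐ[volTime T] y' → z =ᵐ[volTime T] z' →
      ∫ t in Ioo 0 T, ∫ x in ω, v (t, x) * y t x * z t x = inner ℝ (M y') z')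
    (μ : ℝ) (y : L2Time T L2Ω) : M (expWeight μ y) = expWeight μ (M y) := by
  refine ext_inner_right ℝ fun z => ?_
  rw [← inner_expWeight_right, ← hM _ _ (expWeight μ y) z (coeFn_expWeight μ y).symm EventuallyEq.rfl,
    ← hM _ _ y (expWeight μ z) EventuallyEq.rfl (coeFn_expWeight μ z).symm]
  refine integral_congr_ae (Eventually.of_forall fun t => integral_congr_ae ?_)
  have hle : volume.restrict ω ≤ volΩ := Measure.restrict_mono hω_sub le_rfl
  filter_upwards [ae_mono hle (Lp.coeFn_smul (Real.exp (μ * t)) (y t)),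
    ae_mono hle (Lp.coeFn_smul (Real.exp (μ * t)) (z t))] with x e1 e2
  rw [e1, e2, Pi.smul_apply, Pi.smul_apply, smul_eq_mul, smul_eq_mul]
  ring

/-- The data of a test function form a test triple. -/
theorem TestFunction.isTestTriple (φ : TestFunction a T hT) :
    IsTestTriple H1a.toL2 hT (φ.toFun, φ.timeDeriv, φ.initial) :=
  ⟨φ.isWeakTimeDeriv, φ.rep, φ.isContRep, φ.final_eq_zero, rfl⟩

theorem IsTestTriple.exists_testFunction {x : L2Time T (H1a a) × L2Time T L2Ω × L2Ω}
    (hx : IsTestTriple H1a.toL2 hT x) :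
    ∃ φ : TestFunction a T hT, φ.toFun = x.1 ∧ φ.timeDeriv = x.2.1 ∧ φ.initial = x.2.2 := by
  obtain ⟨h1, P, h2, h3, h4⟩ := hx
  exact ⟨⟨x.1, x.2.1, P, h1, h2, h3⟩, rfl, rfl, h4⟩

theorem isWeakSolution_iff_damped_zero {f : L2Time T (H1aDual a)} {p₀ : L2Ω}
    {p : L2Time T (H1a a)} :
    IsWeakSolution a hT ω f v p₀ p ↔ IsWeakSolutionDamped a hT ω 0 f v p₀ p := by
  simp only [IsWeakSolution, IsWeakSolutionDamped, neg_zero, zero_mul, Real.exp_zero, one_mul,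
    add_zero]

variable [CompleteSpace (H1a a)]

/-- The variational formulation, stated with integrals, is the abstract one. -/
theorem isWeakSolutionDamped_iff {M : L2Time T L2Ω →L[ℝ] L2Time T L2Ω}
    (hM : ∀ y z : ℝ → L2Ω, ∀ y' z' : L2Time T L2Ω, y =ᵐ[volTime T] y' → z =ᵐ[volTime T] z' →
      ∫ t in Ioo 0 T, ∫ x in ω, v (t, x) * y t x * z t x = inner ℝ (M y') z')
    {f : L2Time T (H1aDual a)} {F : L2Time T (H1a a)}
    (hF : ∀ᵐ t ∂volTime T, ∀ w : H1a a, inner ℝ (F t) w = f t w) (r : ℝ) (p₀ : L2Ω)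
    (z : L2Time T (H1a a)) : IsWeakSolutionDamped a hT ω r f v p₀ z ↔
      IsDampedEvolution H1a.toL2 H1a.weightedDeriv M hT r F p₀ z := by
  have key : ∀ φ : TestFunction a T hT,
      (-(∫ t in Ioo 0 T, inner ℝ (φ.timeDeriv t) (H1a.toL2 (z t)))
      + (∫ t in Ioo 0 T, inner ℝ (H1a.weightedDeriv (z t)) (H1a.weightedDeriv (φ.toFun t)))
      + r * (∫ t in Ioo 0 T, inner ℝ (H1a.toL2 (z t)) (H1a.toL2 (φ.toFun t)))
      - (∫ t in Ioo 0 T, ∫ x in ω, v (t, x) * H1a.toL2 (z t) x * H1a.toL2 (φ.toFun t) x)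
        = inner ℝ p₀ φ.initial + ∫ t in Ioo 0 T, Real.exp (-r * t) * f t (φ.toFun t)) ↔
      -inner ℝ φ.timeDeriv (H1a.toL2.compLpL 2 (volTime T) z) = inner ℝ p₀ φ.initial
        + inner ℝ (source H1a.toL2 H1a.weightedDeriv M r (expWeight (-r) F) z) φ.toFun := by
    intro φ
    rw [hM (fun t => H1a.toL2 (z t)) (fun t => H1a.toL2 (φ.toFun t)) _ _
      (H1a.toL2.coeFn_compLpL (p := 2) z).symm (H1a.toL2.coeFn_compLpL (p := 2) φ.toFun).symm]
    exact variational_integral_iff (V := H1a a) (H := L2Ω) (f := f) hF r p₀ φ.initial z φ.toFun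
      φ.timeDeriv
  constructor
  · rintro ⟨-, h⟩ x hx
    obtain ⟨φ, h1, h2, h3⟩ := hx.exists_testFunction
    rw [← h1, ← h2, ← h3]
    exact (key φ).1 (h φ)
  · intro h
    exact ⟨IsWeakEvolution.exists_dual_timeDeriv (V := H1a a) (H := L2Ω) h,
      fun φ => (key φ).2 (h _ φ.isTestTriple)⟩

end

section

variable {a : ℝ → ℝ} {T : ℝ} {hT : 0 < T} {ω : Set ℝ}

theorem existsUnique_isWeakSolutionDamped (ha : IsDegenerateCoefficient a) (hT : 0 < T)
    (hω : MeasurableSet ω) (hω_sub : ω ⊆ Ioo (-1) 1) (r : ℝ) (f : L2Time T (H1aDual a))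
    (v : LInfControl T ω) (p₀ : L2Ω) : ∃! z, IsWeakSolutionDamped a hT ω r f v p₀ z := by
  have := completeSpace_H1a ha
  obtain ⟨M, hM, hMv⟩ := exists_potential_operator hω hω_sub v
  obtain ⟨F, -, hF⟩ := exists_riesz (V := H1a a) f
  simp only [isWeakSolutionDamped_iff hM hF]
  exact existsUnique_isDampedEvolution (V := H1a a) (H := L2Ω) hT H1a.toL2_injective
    (eq_zero_of_inner_toL2_eq_zero ha) H1a.norm_sq_eq hMv (potential_expWeight hω_sub hM) r F p₀

theorem IsWeakSolutionDamped.exists_contRep_norm_le (ha : IsDegenerateCoefficient a)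
    (hω : MeasurableSet ω) (hω_sub : ω ⊆ Ioo (-1) 1) {f : L2Time T (H1aDual a)}
    {v : LInfControl T ω} {p₀ : L2Ω} {z : L2Time T (H1a a)}
    (hz : IsWeakSolutionDamped a hT ω (‖v‖ + 1) f v p₀ z) :
    ∃ Z : C(Icc (0 : ℝ) T, L2Ω), IsContRep z Z ∧ ‖Z‖ + ‖z‖ ≤ 2 * (‖p₀‖ + ‖f‖) := by
  have := completeSpace_H1a ha
  obtain ⟨M, hM, hMv⟩ := exists_potential_operator hω hω_sub v
  obtain ⟨F, hFn, hF⟩ := exists_riesz (V := H1a a) f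
  obtain ⟨Z, hZ, hle⟩ := IsDampedEvolution.exists_norm_add_norm_le (V := H1a a) (H := L2Ω)
    H1a.toL2_injective (eq_zero_of_inner_toL2_eq_zero ha) H1a.norm_sq_eq (norm_nonneg v) hMv
    ((isWeakSolutionDamped_iff hM hF _ _ _).1 hz)
  exact ⟨Z, hZ, by linarith⟩

theorem IsWeakSolution.exists_contRep_norm_le (ha : IsDegenerateCoefficient a)
    (hω : MeasurableSet ω) (hω_sub : ω ⊆ Ioo (-1) 1) {f : L2Time T (H1aDual a)}
    {v : LInfControl T ω} {p₀ : L2Ω} {p : L2Time T (H1a a)}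
    (hp : IsWeakSolution a hT ω f v p₀ p) :
    ∃ P : C(Icc (0 : ℝ) T, L2Ω), IsContRep p P ∧
      ‖P‖ + ‖p‖ ≤ 2 * Real.exp ((‖v‖ + 1) * T) * (‖p₀‖ + ‖f‖) := by
  have := completeSpace_H1a ha
  obtain ⟨M, hM, hMv⟩ := exists_potential_operator hω hω_sub v
  obtain ⟨F, hFn, hF⟩ := exists_riesz (V := H1a a) f
  obtain ⟨P, hP, hle⟩ := IsDampedEvolution.exists_norm_add_norm_le_exp (V := H1a a) (H := L2Ω)
    H1a.toL2_injective (eq_zero_of_inner_toL2_eq_zero ha) H1a.norm_sq_eq (norm_nonneg v) hMv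
    (potential_expWeight hω_sub hM)
    ((isWeakSolutionDamped_iff hM hF _ _ _).1 (isWeakSolution_iff_damped_zero.1 hp))
  exact ⟨P, hP, hle.trans (by gcongr)⟩

end

end DegenerateParabolic

end

theorem mainTheorem3 (a : ℝ → ℝ) (ha : DegenerateParabolic.IsDegenerateCoefficient a)
    (T : ℝ) (hT : 0 < T) (ω : Set ℝ) (hω : MeasurableSet ω) (hω_ne : ω.Nonempty)
    (hω_sub : ω ⊆ Ioo (-1) 1) :
    -- the inhomogeneous problem
    (∀ (f : DegenerateParabolic.L2Time T (DegenerateParabolic.H1aDual a))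
        (v : DegenerateParabolic.LInfControl T ω) (p₀ : DegenerateParabolic.L2Ω),
      ∃! p : DegenerateParabolic.L2Time T (DegenerateParabolic.H1a a),
        DegenerateParabolic.IsWeakSolution a hT ω f v p₀ p) ∧
    (∀ (f : DegenerateParabolic.L2Time T (DegenerateParabolic.H1aDual a))
        (v : DegenerateParabolic.LInfControl T ω) (p₀ : DegenerateParabolic.L2Ω)
        (p : DegenerateParabolic.L2Time T (DegenerateParabolic.H1a a)),
      DegenerateParabolic.IsWeakSolution a hT ω f v p₀ p →
        ∃ P : C(Icc (0 : ℝ) T, DegenerateParabolic.L2Ω),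
          DegenerateParabolic.IsContRep p P ∧
          ‖P‖ + ‖p‖ ≤ 2 * Real.exp ((‖v‖ + 1) * T) * (‖p₀‖ + ‖f‖)) ∧
    -- the problem with the additional zero-order term `r z`
    (∀ (r : ℝ), 0 < r → ∀ (f : DegenerateParabolic.L2Time T (DegenerateParabolic.H1aDual a))
        (v : DegenerateParabolic.LInfControl T ω) (p₀ : DegenerateParabolic.L2Ω),
      ∃! z : DegenerateParabolic.L2Time T (DegenerateParabolic.H1a a),
        DegenerateParabolic.IsWeakSolutionDamped a hT ω r f v p₀ z) ∧
    (∀ (f : DegenerateParabolic.L2Time T (DegenerateParabolic.H1aDual a))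
        (v : DegenerateParabolic.LInfControl T ω) (p₀ : DegenerateParabolic.L2Ω)
        (z : DegenerateParabolic.L2Time T (DegenerateParabolic.H1a a)),
      DegenerateParabolic.IsWeakSolutionDamped a hT ω (‖v‖ + 1) f v p₀ z →
        ∃ Z : C(Icc (0 : ℝ) T, DegenerateParabolic.L2Ω),
          DegenerateParabolic.IsContRep z Z ∧
          ‖Z‖ + ‖z‖ ≤ 2 * (‖p₀‖ + ‖f‖)) ∧
    -- the state equation
    (∀ (v : DegenerateParabolic.LInfControl T ω) (y₀ : DegenerateParabolic.L2Ω),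
      ∃! y : DegenerateParabolic.L2Time T (DegenerateParabolic.H1a a),
        DegenerateParabolic.IsWeakSolution a hT ω 0 v y₀ y) ∧
    (∀ (v : DegenerateParabolic.LInfControl T ω) (y₀ : DegenerateParabolic.L2Ω)
        (y : DegenerateParabolic.L2Time T (DegenerateParabolic.H1a a)),
      DegenerateParabolic.IsWeakSolution a hT ω 0 v y₀ y →
        ∃ Y : C(Icc (0 : ℝ) T, DegenerateParabolic.L2Ω),
          DegenerateParabolic.IsContRep y Y ∧
          ‖Y‖ + ‖y‖ ≤ 2 * Real.exp ((‖v‖ + 1) * T) * ‖y₀‖) := by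
  refine ⟨fun f v p₀ => ?_, fun f v p₀ p hp => hp.exists_contRep_norm_le ha hω hω_sub,
    fun r _ f v p₀ => DegenerateParabolic.existsUnique_isWeakSolutionDamped ha hT hω hω_sub r f v p₀,
    fun f v p₀ z hz => hz.exists_contRep_norm_le ha hω hω_sub, fun v y₀ => ?_, fun v y₀ y hy => ?_⟩
  · simp only [DegenerateParabolic.isWeakSolution_iff_damped_zero]
    exact DegenerateParabolic.existsUnique_isWeakSolutionDamped ha hT hω hω_sub 0 f v p₀
  · simp only [DegenerateParabolic.isWeakSolution_iff_damped_zero]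
    exact DegenerateParabolic.existsUnique_isWeakSolutionDamped ha hT hω hω_sub 0 0 v y₀
  · obtain ⟨Y, hY, hle⟩ := hy.exists_contRep_norm_le ha hω hω_sub
    exact ⟨Y, hY, by rwa [norm_zero, add_zero] at hle⟩
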